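/- For $f\in L^1(\mathbb R)\cap L^2(\mathbb R)$ (complex-valued) put $\hat f(\xi)=\int_{\mathbb R} f(x)e^{-2\pi i x\xi}\,dx$, and let \[ \mathcal H=\Bigl\{f\in L^2(\mathbb R):\ \int_{\mathbb R}(1+x^2)|f(x)|^2\,dx+\int_{\mathbb R}(1+\xi^2)|\hat f(\xi)|^2\,d\xi<\infty\Bigr\}, \] where each $f\in\mathcal H$ is identified with its continuous representative. A pair $(\Lambda,M)$ of subsets of $\mathbb R$ is a Fourier uniqueness pair for $\mathcal H$ if $f\in\mathcal H$, $f|_\Lambda=0$ and $\hat f|_M=0$ imply $f\equiv 0$. Let $0<s<1$. Then there exist strictly increasing sequences $\Lambda=(\lambda_j)_{j\in\mathbb Z}$ and $M=(\mu_j)_{j\in\mathbb Z}$ of real numbers with $\lim_{j\to\pm\infty}\lambda_j=\pm\infty$ and $\lim_{j\to\pm\infty}\mu_j=\pm\infty$ such that, as $j\to+\infty$, \[ \lambda_j\sim\Bigl(\frac{\log j}{4\pi}\Bigr)^{1/s},\qquad -\lambda_{-j}\sim\Bigl(\frac{\log j}{4\pi}\Bigr)^{1/s},\qquad \mu_j\sim\frac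 j2\Bigl(\frac{4\pi}{\log j}\Bigr)^{1/s},\qquad -\mu_{-j}\sim\frac j2\Bigl(\frac{4\pi}{\log j}\Bigr)^{1/s}, \] and $(\Lambda,M)$ is a Fourier uniqueness pair for $\mathcal H$. Moreover, as $s\to1^-$, for each fixed $j\ge2$ these growth rates converge to $\frac{\log j}{4\pi}$ and $\frac{2\pi j}{\log j}$ respectively, which are the growth rates of the Bondarenko--Radchenko--Seip pair, formed by the points $\frac{\log j}{4\pi}$ and the nontrivial zeros of the Riemann zeta function. -/

import Mathlib

open Filter Topology MeasureTheory Asymptotics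
open scoped FourierTransform

/-- The Fourier symmetric Sobolev space `𝓗` of the line: square integrable `f : ℝ → ℂ` with
`∫ (1 + x²) |f(x)|² dx + ∫ (1 + ξ²) |f̂(ξ)|² dξ < ∞`. Since such an `f` and its Fourier transform are
integrable, every class in this space has a unique continuous representative, and point values
refer to it; so the space is described here by these representatives. The Fourier transform is
Mathlib's `f̂(ξ) = ∫ f(x) exp (-2πi x ξ) dx`. -/
def FourierSymmetricSobolev : Set (ℝ → ℂ) :=
  {f | Continuous f ∧ MemLp f 2 volume ∧
    Integrable (fun x : ℝ => (1 + x ^ 2) * ‖f x‖ ^ 2) volume ∧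
    Integrable (fun ξ : ℝ => (1 + ξ ^ 2) * ‖𝓕 f ξ‖ ^ 2) volume}

/-- The members of the space are integrable, so the integral that defines `𝓕 f` converges. -/
theorem FourierSymmetricSobolev.integrable {f : ℝ → ℂ} (hf : f ∈ FourierSymmetricSobolev) :
    Integrable f volume := by
  obtain ⟨hc, -, hw, -⟩ := hf
  refine (hw.add integrable_inv_one_add_sq).mono' hc.aestronglyMeasurable
    (Eventually.of_forall fun x => ?_)
  have h1 : (0 : ℝ) < 1 + x ^ 2 := by positivity
  have h2 : (1 + x ^ 2) * (1 + x ^ 2)⁻¹ = 1 := mul_inv_cancel₀ h1.ne'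
  have h3 : (0 : ℝ) < (1 + x ^ 2)⁻¹ := inv_pos.mpr h1
  have h4 : 0 ≤ (1 + x ^ 2) * (‖f x‖ - (1 + x ^ 2)⁻¹) ^ 2 := by positivity
  have h5 : (1 + x ^ 2) * (‖f x‖ - (1 + x ^ 2)⁻¹) ^ 2
      = (1 + x ^ 2) * ‖f x‖ ^ 2 - 2 * ‖f x‖ * ((1 + x ^ 2) * (1 + x ^ 2)⁻¹)
        + ((1 + x ^ 2) * (1 + x ^ 2)⁻¹) * (1 + x ^ 2)⁻¹ := by ring
  rw [h5, h2] at h4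
  have h6 := norm_nonneg (f x)
  simp only [Pi.add_apply]
  linarith

/-- `(Λ, M)` is a Fourier uniqueness pair for a space `X` of functions on the line. -/
def IsFourierUniquenessPair (Λ M : Set ℝ) (X : Set (ℝ → ℂ)) : Prop :=
  ∀ f ∈ X, (∀ x ∈ Λ, f x = 0) → (∀ ξ ∈ M, 𝓕 f ξ = 0) → f = 0

/-- A strictly increasing two-sided sequence of reals with limits `±∞` at `±∞`. -/
def IsOrderedSequence (a : ℤ → ℝ) : Prop :=
  StrictMono a ∧ Tendsto a atTop atTop ∧ Tendsto a atBot atBot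

/-- The growth rate `(log j / (4π)) ^ (1/s)`. -/
noncomputable def lambdaRate (s : ℝ) (j : ℕ) : ℝ :=
  (Real.log j / (4 * Real.pi)) ^ (1 / s)

/-- The growth rate `(j / 2) (4π / log j) ^ (1/s)`. -/
noncomputable def muRate (s : ℝ) (j : ℕ) : ℝ :=
  (j : ℝ) / 2 * (4 * Real.pi / Real.log j) ^ (1 / s)

/-!
The proof plays two Poincaré inequalities against each other. For `f` in the space write
`w(x) = (1 + x²) exp (4π |x| ^ s)` (`spaceWeight`), `F = ∫ w² |f|²` and `G = ∫ ξ² |𝓕 f|²`.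

On the space side the zeros `Λ` of `f` are so dense, with gaps at most `1 / (C₀ w)`, that the
Poincaré inequality on each gap, with any constant, gives `C₀² F ≤ 4π² G`
(`lintegral_spaceWeight_sq_le`). Multiplying the density by the constant `C₀` and by powers of `x`
does not change the asymptotics `log j ~ 4π λ_j ^ s`, so `C₀` may be taken as large as needed.

On the frequency side the zeros `M` of `𝓕 f` give the reverse inequality `G ≤ C F` with an
absolute constant `C` (`exists_lintegral_sq_mul_fourier_le`). Here the density is critical and the
sharp constant in Wirtinger's inequality is needed. To estimate the energy above the frequency
`K`, the low frequencies are removed by a smooth cutoff: `h = (1 - θ(ξ / K)) 𝓕 f` is the transform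
of a function `p`, and it still vanishes on `M`. If the gaps of `M` beyond `K / 2` are shorter
than `1 / (2 (R + 2))`, Wirtinger's inequality reads `(R + 2)² ∫ |p|² ≤ ∫ x² |p|²`; the part
`|x| ≤ R + 1` of the right-hand side is absorbed, so `∫ |p|²` is at most `∫ x² |p|²` over
`|x| > R + 1` (`lintegral_enorm_sq_le_tail`). Since `p` is `f` minus a convolution of `f` with a
kernel living at scale `1 / K`, that tail comes from the tail of `f` beyond `R`, up to `O(K⁻³)`
(`setLIntegral_high_frequency_le`). Taking `K = 2 ^ j`, `R = (log K / (4π)) ^ (1 / s)`, and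
summing over `j` with weights `4 ^ j` turns the condition `R < |x|`, that is
`K < exp (4π |x| ^ s)`, into the exponential weight.

The two inequalities force `F = 0` once `C₀² > 4π² C`. The sequences are the points where
`x ρ(|x|)` takes integer values, for the prescribed densities `ρ` (`exists_sequence_of_density`),
and their growth rates follow by taking logarithms.
-/

/-! ### Plancherel's theorem for integrable square-integrable functions -/

theorem Real.continuous_fourier_of_integrable {u : ℝ → ℂ} (hu : Integrable u) :
    Continuous (𝓕 u) :=
  VectorFourier.fourierIntegral_continuous Real.continuous_fourierChar
    (by exact continuous_inner) hu

theorem integral_fourier_mul_eq_of_integrable {u v : ℝ → ℂ} (hu : Integrable u)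
    (hv : Integrable v) : ∫ ξ, 𝓕 u ξ * v ξ = ∫ x, u x * 𝓕 v x := by
  simpa using! VectorFourier.integral_fourierIntegral_smul_eq_flip (L := innerₗ ℝ)
    Real.continuous_fourierChar continuous_inner hu hv

/-- The transform of an `L²` class agrees with the integral transform on `L¹ ∩ L²`: both define the
same tempered distribution. -/
theorem fourier_toLp_ae_eq {u : ℝ → ℂ} (h1 : Integrable u) (h2 : MemLp u 2) :
    (𝓕 (h2.toLp u) : Lp (α := ℝ) ℂ 2) =ᵐ[volume] 𝓕 u := by
  apply ae_eq_of_integral_contDiff_smul_eq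
  · exact (Lp.memLp _).locallyIntegrable (by norm_num)
  · exact (Real.continuous_fourier_of_integrable h1).locallyIntegrable
  · intro φ hφ hc
    have hφ' : ContDiff ℝ (⊤ : ℕ∞) (fun x => (φ x : ℂ)) := Complex.ofRealCLM.contDiff.comp hφ
    have hc' : HasCompactSupport (fun x => (φ x : ℂ)) :=
      hc.comp_left (g := fun t : ℝ => (t : ℂ)) (by simp)
    set S : SchwartzMap ℝ ℂ := hc'.toSchwartzMap hφ' with hS
    have hSφ : ∀ x, S x = (φ x : ℂ) := fun x => rfl
    have key := congrArg (fun T => T S) (Lp.fourier_toTemperedDistribution_eq (h2.toLp u))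
    simp only [TemperedDistribution.fourier_apply, Lp.toTemperedDistribution_apply] at key
    have e1 : ∫ x, φ x • (𝓕 (h2.toLp u) : Lp (α := ℝ) ℂ 2 volume) x
        = ∫ x, S x • (𝓕 (h2.toLp u) : Lp (α := ℝ) ℂ 2 volume) x := by
      simp [hSφ]
    rw [e1, ← key]
    have e2 : ∫ x, (𝓕 S) x • (h2.toLp u) x = ∫ x, u x * 𝓕 (S : ℝ → ℂ) x := by
      apply integral_congr_ae
      filter_upwards [h2.coeFn_toLp] with x hx
      rw [hx, SchwartzMap.fourier_coe, smul_eq_mul, mul_comm]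
    rw [e2, ← integral_fourier_mul_eq_of_integrable h1 S.integrable]
    simp [hSφ, mul_comm]

theorem eLpNorm_two_sq (u : ℝ → ℂ) : eLpNorm u 2 volume ^ 2 = ∫⁻ x, ‖u x‖ₑ ^ 2 := by
  have h := eLpNorm_nnreal_pow_eq_lintegral (f := u) (μ := volume) (p := 2) (by norm_num)
  norm_num at h
  exact_mod_cast h

/-- Plancherel's theorem for the integral transform of `L¹ ∩ L²` functions. -/
theorem lintegral_enorm_fourier_sq {u : ℝ → ℂ} (h1 : Integrable u) (h2 : MemLp u 2) :
    ∫⁻ ξ, ‖𝓕 u ξ‖ₑ ^ 2 = ∫⁻ x, ‖u x‖ₑ ^ 2 := by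
  have h := congrArg ENNReal.ofReal (Lp.norm_fourier_eq (h2.toLp u))
  rw [Lp.norm_def, Lp.norm_def, ENNReal.ofReal_toReal (Lp.eLpNorm_ne_top _),
    ENNReal.ofReal_toReal (Lp.eLpNorm_ne_top _), eLpNorm_congr_ae (fourier_toLp_ae_eq h1 h2),
    eLpNorm_congr_ae h2.coeFn_toLp] at h
  rw [← eLpNorm_two_sq, ← eLpNorm_two_sq, h]

/-- Plancherel's theorem for the inverse integral transform. -/
theorem lintegral_enorm_fourierInv_sq {u : ℝ → ℂ} (h1 : Integrable u) (h2 : MemLp u 2) :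
    ∫⁻ ξ, ‖𝓕⁻ u ξ‖ₑ ^ 2 = ∫⁻ x, ‖u x‖ₑ ^ 2 := by
  rw [← lintegral_enorm_fourier_sq h1 h2, ← lintegral_neg_eq_self]
  simp_rw [Real.fourierInv_eq_fourier_neg, neg_neg]

/-! ### Sequences with a prescribed density -/

/-- For a nondecreasing density `ρ ≥ 1`, the points where the odd counting function `x ρ(|x|)`
takes integer values have gaps at most `1 / ρ`. -/
theorem exists_sequence_of_density {ρ : ℝ → ℝ} (hc : Continuous ρ)
    (hm : MonotoneOn ρ (Set.Ici 0)) (h1 : ∀ x, 0 ≤ x → 1 ≤ ρ x) :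
    ∃ a : ℤ → ℝ, IsOrderedSequence a ∧ (∀ j, a (-j) = -a j) ∧ (∀ j, a j * ρ |a j| = j) ∧
      ∀ j, ∀ x ∈ Set.Icc (a j) (a (j + 1)), (a (j + 1) - a j) * ρ |x| ≤ 1 := by
  set n : ℝ → ℝ := fun x => x * ρ |x| with hn
  have hρ : ∀ x, 1 ≤ ρ |x| := fun x => h1 _ (abs_nonneg x)
  have hodd : ∀ x, n (-x) = -n x := fun x => by simp [hn]
  -- since `ρ x ≤ ρ y`, the density at the far end of an interval bounds the increment of `n`
  have hgap : ∀ x y, 0 ≤ x → x ≤ y → (y - x) * ρ y ≤ n y - n x := by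
    intro x y hx hxy
    have h := hm hx (hx.trans hxy) hxy
    simp only [hn, abs_of_nonneg hx, abs_of_nonneg (hx.trans hxy)]
    nlinarith
  have hpos : StrictMonoOn n (Set.Ici 0) := by
    intro x hx y hy hxy
    have h2 := hgap x y hx hxy.le
    have h3 := h1 y hy
    nlinarith
  have hneg : StrictMonoOn n (Set.Iic 0) := by
    intro x hx y hy hxy
    have h := hpos (a := -y) (b := -x) (by simpa using hy) (by simpa using hx) (by linarith)
    rw [hodd, hodd] at h
    linarith
  have hmono : StrictMono n := hneg.Iic_union_Ici hpos
  have hcont : Continuous n := continuous_id.mul (hc.comp continuous_abs)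
  have htop : Tendsto n atTop atTop := by
    refine tendsto_atTop_mono' _ ?_ tendsto_id
    filter_upwards [eventually_ge_atTop 0] with x hx
    simpa using le_mul_of_one_le_right hx (hρ x)
  have hbot : Tendsto n atBot atBot := by
    refine tendsto_atBot_mono' _ ?_ tendsto_id
    filter_upwards [eventually_le_atBot 0] with x hx
    have := hρ x
    simp only [hn, id]
    nlinarith
  set e : ℝ ≃o ℝ := hmono.orderIsoOfSurjective n (hcont.surjective htop hbot) with he
  have hen : ∀ x, n (e.symm x) = x := fun x => e.apply_symm_apply x
  have hsymm_neg : ∀ x, e.symm (-x) = -e.symm x := fun x =>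
    hmono.injective (by rw [hen, hodd, hen])
  have h0 : e.symm 0 = 0 := by
    have := hsymm_neg 0
    rw [neg_zero] at this
    linarith
  refine ⟨fun j => e.symm j, ⟨fun i j h => e.symm.strictMono (by exact_mod_cast h),
    e.symm.tendsto_atTop.comp tendsto_intCast_atTop_atTop,
    e.symm.tendsto_atBot.comp (tendsto_intCast_atBot_iff.2 tendsto_id)⟩,
    fun j => by push_cast; exact hsymm_neg j, fun j => hen j, ?_⟩
  intro j x hx
  have hle : e.symm (j : ℝ) ≤ e.symm ((j + 1 : ℤ) : ℝ) := hx.1.trans hx.2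
  have hdiff : n (e.symm ((j + 1 : ℤ) : ℝ)) - n (e.symm (j : ℝ)) = 1 := by
    rw [hen, hen]; push_cast; ring
  -- `0` is the point of index `0`, so no gap contains it in its interior
  rcases le_or_gt 0 j with hj | hj
  · have ha : 0 ≤ e.symm (j : ℝ) := by
      rw [← h0]; exact e.symm.monotone (by exact_mod_cast hj)
    have hx0 : 0 ≤ x := ha.trans hx.1
    calc _ ≤ (e.symm ((j + 1 : ℤ) : ℝ) - e.symm (j : ℝ)) * ρ (e.symm ((j + 1 : ℤ) : ℝ)) := by
            rw [abs_of_nonneg hx0]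
            exact mul_le_mul_of_nonneg_left (hm hx0 (hx0.trans hx.2) hx.2) (by linarith)
      _ ≤ 1 := hdiff ▸ hgap _ _ ha hle
  · have hb : e.symm ((j + 1 : ℤ) : ℝ) ≤ 0 := by
      rw [← h0]; exact e.symm.monotone (by exact_mod_cast hj)
    have hx0 : x ≤ 0 := hx.2.trans hb
    have hg := hgap (-e.symm ((j + 1 : ℤ) : ℝ)) (-e.symm (j : ℝ)) (by linarith) (by linarith)
    rw [hodd, hodd] at hg
    calc _ ≤ (e.symm ((j + 1 : ℤ) : ℝ) - e.symm (j : ℝ)) * ρ (-e.symm (j : ℝ)) := by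
            rw [abs_of_nonpos hx0]
            refine mul_le_mul_of_nonneg_left (hm ?_ ?_ (by linarith [hx.1])) (by linarith)
            · simpa using hx0
            · simpa using hx.1.trans hx0
      _ ≤ 1 := by linarith

theorem IsOrderedSequence.iUnion_Ioc {a : ℤ → ℝ} (ha : IsOrderedSequence a) :
    ⋃ j, Set.Ioc (a j) (a (j + 1)) = Set.univ := by
  refine Set.eq_univ_of_forall fun x => Set.mem_iUnion.2 ?_
  obtain ⟨i, hi⟩ := (ha.2.2.eventually (eventually_lt_atBot x)).exists
  obtain ⟨k, hk⟩ := (ha.2.1.eventually (eventually_ge_atTop x)).exists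
  obtain ⟨m, hm, hmax⟩ := Int.exists_greatest_of_bdd (P := fun j => a j < x)
    ⟨k, fun z hz => (ha.1.lt_iff_lt.1 (hz.trans_le hk)).le⟩ ⟨i, hi⟩
  exact ⟨m, hm, not_lt.1 fun h => by have := hmax _ h; omega⟩

theorem IsOrderedSequence.lintegral_eq_tsum {a : ℤ → ℝ} (ha : IsOrderedSequence a)
    (F : ℝ → ENNReal) : ∫⁻ x, F x = ∑' j, ∫⁻ x in Set.Ioc (a j) (a (j + 1)), F x := by
  rw [← setLIntegral_univ, ← ha.iUnion_Ioc, lintegral_iUnion (fun _ => measurableSet_Ioc)]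
  simpa using ha.1.monotone.pairwise_disjoint_on_Ioc_succ

theorem IsOrderedSequence.lintegral_le {a : ℤ → ℝ} (ha : IsOrderedSequence a)
    {F G : ℝ → ENNReal}
    (h : ∀ j, ∫⁻ x in Set.Ioc (a j) (a (j + 1)), F x ≤ ∫⁻ x in Set.Ioc (a j) (a (j + 1)), G x) :
    ∫⁻ x, F x ≤ ∫⁻ x, G x := by
  rw [ha.lintegral_eq_tsum, ha.lintegral_eq_tsum]
  exact ENNReal.tsum_le_tsum h

/-- Fatou's lemma over the gaps: only the estimate on each single gap has to survive the limit. -/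
theorem IsOrderedSequence.lintegral_le_of_liminf {a : ℤ → ℝ} (ha : IsOrderedSequence a)
    {F : ℝ → ENNReal} {G : ℕ → ℝ → ENNReal} {C : ENNReal}
    (h : ∀ j, ∫⁻ x in Set.Ioc (a j) (a (j + 1)), F x ≤
      liminf (fun N => ∫⁻ x in Set.Ioc (a j) (a (j + 1)), G N x) atTop)
    (hC : ∀ N, ∫⁻ x, G N x ≤ C) : ∫⁻ x, F x ≤ C := by
  rw [ha.lintegral_eq_tsum]
  calc _ ≤ ∑' j, liminf (fun N => ∫⁻ x in Set.Ioc (a j) (a (j + 1)), G N x) atTop :=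
        ENNReal.tsum_le_tsum h
    _ ≤ liminf (fun N => ∑' j, ∫⁻ x in Set.Ioc (a j) (a (j + 1)), G N x) atTop := by
        simp_rw [← lintegral_count]
        exact lintegral_liminf_le fun N => measurable_of_countable _
    _ ≤ C := by
        simp_rw [← ha.lintegral_eq_tsum]
        exact liminf_le_of_le (by isBoundedDefault) fun b hb => by
          obtain ⟨N, hN⟩ := hb.exists
          exact hN.trans (hC N)

/-! ### Poincaré inequality with weights -/

theorem ENNReal.lintegral_mul_sq_le {α : Type*} [MeasurableSpace α] {μ : Measure α}
    {f g : α → ENNReal} (hf : AEMeasurable f μ) (hg : AEMeasurable g μ) :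
    (∫⁻ x, f x * g x ∂μ) ^ 2 ≤ (∫⁻ x, f x ^ 2 ∂μ) * ∫⁻ x, g x ^ 2 ∂μ := by
  have h := ENNReal.lintegral_mul_le_Lp_mul_Lq μ Real.HolderConjugate.two_two hf hg
  have h2 : ∀ t : ENNReal, (t ^ (1 / 2 : ℝ)) ^ 2 = t := fun t => by
    rw [← ENNReal.rpow_natCast, ← ENNReal.rpow_mul]; norm_num
  calc _ ≤ ((∫⁻ x, f x ^ (2 : ℝ) ∂μ) ^ (1 / 2 : ℝ) * (∫⁻ x, g x ^ (2 : ℝ) ∂μ) ^ (1 / 2 : ℝ)) ^ 2 :=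
        pow_le_pow_left' h 2
    _ = _ := by rw [mul_pow, h2, h2]; simp

theorem ENNReal.lintegral_weight_mul_sq_le {α : Type*} [MeasurableSpace α] {μ : Measure α}
    {k f : α → ENNReal} (hk : AEMeasurable k μ) (hf : AEMeasurable f μ) :
    (∫⁻ x, k x * f x ∂μ) ^ 2 ≤ (∫⁻ x, k x ∂μ) * ∫⁻ x, k x * f x ^ 2 ∂μ := by
  have h2 : ∀ t : ENNReal, (t ^ (1 / 2 : ℝ)) ^ 2 = t := fun t => by
    rw [← ENNReal.rpow_natCast, ← ENNReal.rpow_mul]; norm_num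
  have h := ENNReal.lintegral_mul_sq_le (hk.pow_const (1 / 2 : ℝ))
    ((hk.pow_const (1 / 2 : ℝ)).mul hf)
  simp only [Pi.mul_apply, mul_pow, h2, ← mul_assoc, ← sq] at h
  exact h

theorem ENNReal.setLIntegral_sq_le {α : Type*} [MeasurableSpace α] {μ : Measure α} {s : Set α}
    {f : α → ENNReal} (hf : AEMeasurable f (μ.restrict s)) :
    (∫⁻ x in s, f x ∂μ) ^ 2 ≤ μ s * ∫⁻ x in s, f x ^ 2 ∂μ := by
  simpa using ENNReal.lintegral_weight_mul_sq_le (k := fun _ => 1) aemeasurable_const hf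

theorem hasDerivAt_fourierInv {u : ℝ → ℂ} (hu : Integrable u)
    (hu' : Integrable fun ξ : ℝ => ξ • u ξ) (x : ℝ) :
    HasDerivAt (𝓕⁻ u) (𝓕⁻ (fun ξ : ℝ => (2 * Real.pi * Complex.I * ξ) * u ξ) x) x := by
  have h := (Real.hasDerivAt_fourier hu hu' (-x)).scomp x (hasDerivAt_neg x)
  have e : (𝓕⁻ u) = (𝓕 u) ∘ Neg.neg := by
    ext y; simp [Real.fourierInv_eq_fourier_neg]
  rw [e]
  convert! h using 1
  rw [Real.fourierInv_eq_fourier_neg, Real.fourier_real_eq, Real.fourier_real_eq,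
    neg_one_smul, ← integral_neg]
  congr 1
  ext y
  simp

theorem Real.continuous_fourierInv_of_integrable {u : ℝ → ℂ} (hu : Integrable u) :
    Continuous (𝓕⁻ u) := by
  have e : (𝓕⁻ u) = (𝓕 u) ∘ Neg.neg := by
    ext y; simp [Real.fourierInv_eq_fourier_neg]
  rw [e]
  exact (Real.continuous_fourier_of_integrable hu).comp continuous_neg

/-- A Poincaré inequality with a non-optimal constant, for increments from the left endpoint. -/
theorem setLIntegral_increment_le {v v' : ℝ → ℂ} (hv : ∀ x, HasDerivAt v (v' x) x)
    (hv' : Continuous v') {a b : ℝ} {W : ℝ → ENNReal}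
    (hW : ∀ x ∈ Set.Ioc a b, ENNReal.ofReal (b - a) * W x ≤ 1) :
    ∫⁻ x in Set.Ioc a b, W x ^ 2 * ‖v x - v a‖ₑ ^ 2 ≤ ∫⁻ x in Set.Ioc a b, ‖v' x‖ₑ ^ 2 := by
  rcases le_or_gt b a with hab | hab
  · simp [Set.Ioc_eq_empty_of_le hab]
  set ℓ := ENNReal.ofReal (b - a) with hℓ
  set D := ∫⁻ x in Set.Ioc a b, ‖v' x‖ₑ ^ 2 with hD
  have hℓ0 : ℓ ≠ 0 := by simpa [hℓ] using hab
  have hℓt : ℓ ≠ ⊤ := ENNReal.ofReal_ne_top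
  have hpt : ∀ x ∈ Set.Ioc a b, W x ^ 2 * ‖v x - v a‖ₑ ^ 2 ≤ ℓ⁻¹ * D := by
    intro x hx
    have h1 : ‖v x - v a‖ₑ ≤ ∫⁻ y in Set.Ioc a b, ‖v' y‖ₑ := by
      rw [← intervalIntegral.integral_eq_sub_of_hasDerivAt (fun y _ => hv y)
        (hv'.intervalIntegrable _ _), intervalIntegral.integral_of_le hx.1.le]
      exact (enorm_integral_le_lintegral_enorm _).trans
        (lintegral_mono_set (Set.Ioc_subset_Ioc_right hx.2))
    have h2 : ‖v x - v a‖ₑ ^ 2 ≤ ℓ * D := by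
      refine (pow_le_pow_left' h1 2).trans ?_
      simpa [Real.volume_Ioc] using
        ENNReal.setLIntegral_sq_le (μ := volume) (s := Set.Ioc a b)
          (hv'.enorm.measurable.aemeasurable)
    have h3 : W x ≤ ℓ⁻¹ := by
      rw [ENNReal.le_inv_iff_mul_le, mul_comm]; exact hW x hx
    calc _ ≤ ℓ⁻¹ ^ 2 * (ℓ * D) := mul_le_mul' (pow_le_pow_left' h3 2) h2
      _ = ℓ⁻¹ * (ℓ⁻¹ * ℓ) * D := by ring
      _ = ℓ⁻¹ * D := by rw [ENNReal.inv_mul_cancel hℓ0 hℓt, mul_one]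
  calc _ ≤ ∫⁻ x in Set.Ioc a b, ℓ⁻¹ * D := setLIntegral_mono' measurableSet_Ioc hpt
    _ = D * (ℓ⁻¹ * ℓ) := by rw [setLIntegral_const, Real.volume_Ioc]; ring
    _ = D := by rw [ENNReal.inv_mul_cancel hℓ0 hℓt, mul_one]

/-- If `f` vanishes on a sequence with gaps at most `1 / W`, then the weighted norm of `f` is
bounded by the norm of its derivative. The derivative exists only in `L²`, so the estimate is made
for the band-limited truncations of `f`, which need not vanish on the sequence, but whose
increments converge to those of `f`. -/
theorem lintegral_weight_sq_le_of_zeros {f : ℝ → ℂ} (hf : Continuous f) (hf1 : Integrable f)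
    (hg1 : Integrable (𝓕 f)) {a : ℤ → ℝ} (ha : IsOrderedSequence a) {W : ℝ → ENNReal}
    (hWm : Measurable W) (hWt : ∀ x, W x ≠ ⊤)
    (hW : ∀ j, ∀ x ∈ Set.Ioc (a j) (a (j + 1)), ENNReal.ofReal (a (j + 1) - a j) * W x ≤ 1)
    (hz : ∀ j, f (a j) = 0) :
    ∫⁻ x, W x ^ 2 * ‖f x‖ₑ ^ 2 ≤
      ∫⁻ ξ : ℝ, ‖(2 * Real.pi * Complex.I * ξ) * 𝓕 f ξ‖ₑ ^ 2 := by
  set g := 𝓕 f with hg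
  have hgc : Continuous g := Real.continuous_fourier_of_integrable hf1
  set u : ℕ → ℝ → ℂ := fun N => (Set.Icc (-N : ℝ) N).indicator g with hu
  have hui : ∀ N, Integrable (u N) := fun N => hg1.indicator measurableSet_Icc
  have hind : ∀ (N : ℕ) (q : ℝ → ℂ), (fun ξ => q ξ * u N ξ)
      = (Set.Icc (-N : ℝ) N).indicator (fun ξ => q ξ * g ξ) := by
    intro N q
    ext ξ
    by_cases h : ξ ∈ Set.Icc (-N : ℝ) N <;> simp [hu, h]
  have hcomp : ∀ (N : ℕ) (q : ℝ → ℂ), Continuous q → Integrable fun ξ => q ξ * u N ξ := by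
    intro N q hq
    rw [hind, integrable_indicator_iff measurableSet_Icc]
    exact (hq.mul hgc).continuousOn.integrableOn_compact isCompact_Icc
  have hq : Continuous fun ξ : ℝ => (2 * Real.pi * Complex.I * ξ : ℂ) := by fun_prop
  set d : ℕ → ℝ → ℂ := fun N => 𝓕⁻ (fun ξ : ℝ => (2 * Real.pi * Complex.I * ξ) * u N ξ) with hd
  have hderiv : ∀ N x, HasDerivAt (𝓕⁻ (u N)) (d N x) x := fun N x =>
    hasDerivAt_fourierInv (hui N) (by simpa using hcomp N _ Complex.continuous_ofReal) x
  have hdc : ∀ N, Continuous (d N) := fun N =>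
    Real.continuous_fourierInv_of_integrable (hcomp N _ hq)
  -- Fourier inversion, since `𝓕 f` is integrable
  have hlim : ∀ x, Tendsto (fun N => 𝓕⁻ (u N) x) atTop (𝓝 (f x)) := by
    intro x
    rw [← congrFun (hf.fourierInv_fourier_eq hf1 hg1) x]
    simp_rw [Real.fourierInv_eq]
    refine tendsto_integral_of_dominated_convergence (fun ξ => ‖g ξ‖) (fun N => ?_) hg1.norm
      (fun N => Eventually.of_forall fun ξ => ?_) (Eventually.of_forall fun ξ => ?_)
    · have h := (Real.fourierIntegral_convergent_iff (-x)).2 (hui N)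
      simpa using h.aestronglyMeasurable
    · rw [Circle.norm_smul]
      exact norm_indicator_le_norm_self _ _
    · refine tendsto_const_nhds.smul (tendsto_const_nhds.congr' ?_)
      obtain ⟨n, hn⟩ := exists_nat_ge |ξ|
      filter_upwards [eventually_ge_atTop n] with N hN
      have : |ξ| ≤ N := hn.trans (by exact_mod_cast hN)
      exact (Set.indicator_of_mem (show ξ ∈ Set.Icc (-N : ℝ) N from abs_le.1 this) g).symm
  refine ha.lintegral_le_of_liminf (G := fun N x => ‖d N x‖ₑ ^ 2) (fun j => ?_) (fun N => ?_)
  · calc _ = ∫⁻ x in Set.Ioc (a j) (a (j + 1)), liminf (fun N =>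
          W x ^ 2 * ‖𝓕⁻ (u N) x - 𝓕⁻ (u N) (a j)‖ₑ ^ 2) atTop := by
          refine lintegral_congr fun x => (Tendsto.liminf_eq ?_).symm
          refine ENNReal.Tendsto.const_mul ?_ (Or.inr (ENNReal.pow_ne_top (hWt x)))
          have h := (hlim x).sub (hlim (a j))
          rw [hz, sub_zero] at h
          exact (ENNReal.continuous_pow 2).continuousAt.tendsto.comp h.enorm
      _ ≤ liminf (fun N => ∫⁻ x in Set.Ioc (a j) (a (j + 1)),
          W x ^ 2 * ‖𝓕⁻ (u N) x - 𝓕⁻ (u N) (a j)‖ₑ ^ 2) atTop := by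
          refine lintegral_liminf_le fun N => (hWm.pow_const 2).mul ?_
          exact ((((Real.continuous_fourierInv_of_integrable (hui N)).sub
            continuous_const).enorm).measurable).pow_const 2
      _ ≤ _ := liminf_le_liminf (Eventually.of_forall fun N =>
          setLIntegral_increment_le (hderiv N) (hdc N) (hW j))
  · rw [lintegral_enorm_fourierInv_sq (hcomp N _ hq)]
    · refine lintegral_mono fun ξ => pow_le_pow_left' ?_ 2
      rw [congrFun (hind N fun ξ => 2 * Real.pi * Complex.I * ξ) ξ]
      exact enorm_indicator_le_enorm_self _ _
    · rw [hind, memLp_indicator_iff_restrict measurableSet_Icc]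
      refine (memLp_two_iff_integrable_sq_norm (hq.mul hgc).aestronglyMeasurable).2 ?_
      exact ((hq.mul hgc).norm.pow 2).continuousOn.integrableOn_compact isCompact_Icc

/-! ### Wirtinger's inequality and functions without low frequencies -/

/-- Wirtinger's inequality with any constant short of the optimal one. The function
`φ(x) = tan (c (x - m))`, `m` the midpoint, is smooth on `[a, b]` and solves `φ' = c (1 + φ²)`, so
`‖h'‖² - c² ‖h‖² = ‖h' + c φ h‖² - c (φ ‖h‖²)'`. -/
theorem integral_norm_sq_le_of_zeros {h h' : ℝ → ℂ} (hd : ∀ x, HasDerivAt h (h' x) x)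
    (hc' : Continuous h') {a b c : ℝ} (hab : a ≤ b) (ha : h a = 0) (hb : h b = 0) (hc : 0 ≤ c)
    (hcab : c * (b - a) < Real.pi) :
    c ^ 2 * ∫ x in a..b, ‖h x‖ ^ 2 ≤ ∫ x in a..b, ‖h' x‖ ^ 2 := by
  have hhc : Continuous h := continuous_iff_continuousAt.2 fun x => (hd x).continuousAt
  set m := (a + b) / 2 with hm
  set φ : ℝ → ℝ := fun x => Real.tan (c * (x - m)) with hφ
  have hcos : ∀ x ∈ Set.uIcc a b, Real.cos (c * (x - m)) ≠ 0 := by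
    intro x hx
    rw [Set.uIcc_of_le hab] at hx
    refine (Real.cos_pos_of_mem_Ioo ⟨?_, ?_⟩).ne'
    · have := mul_le_mul_of_nonneg_left (show -((b - a) / 2) ≤ x - m by linarith [hx.1]) hc
      linarith
    · have := mul_le_mul_of_nonneg_left (show x - m ≤ (b - a) / 2 by linarith [hx.2]) hc
      linarith
  have hφd : ∀ x ∈ Set.uIcc a b, HasDerivAt φ (c * (1 + φ x ^ 2)) x := by
    intro x hx
    have h1 := (Real.hasDerivAt_tan (hcos x hx)).comp x
      (((hasDerivAt_id x).sub_const m).const_mul c)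
    convert! h1 using 1
    have h2 := Real.inv_one_add_tan_sq (hcos x hx)
    have h3 : (0 : ℝ) < 1 + φ x ^ 2 := by positivity
    rw [one_div, ← h2, inv_inv]
    simp only [hφ]
    ring
  have hφc : ContinuousOn φ (Set.uIcc a b) := fun x hx => (hφd x hx).continuousAt.continuousWithinAt
  set D : ℝ → ℝ := fun x => c * (1 + φ x ^ 2) * ‖h x‖ ^ 2 + φ x * (2 * inner ℝ (h x) (h' x)) with hD
  have hin : Continuous fun x => (2 * inner ℝ (h x) (h' x) : ℝ) :=
    continuous_const.mul (hhc.inner hc')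
  have hDc : ContinuousOn D (Set.uIcc a b) :=
    ((continuousOn_const.mul (continuousOn_const.add (hφc.pow 2))).mul
      (hhc.norm.pow 2).continuousOn).add (hφc.mul hin.continuousOn)
  have hDi : IntervalIntegrable D volume a b := hDc.intervalIntegrable
  have hzero : ∫ x in a..b, D x = 0 := by
    rw [intervalIntegral.integral_eq_sub_of_hasDerivAt (f := fun x => φ x * ‖h x‖ ^ 2)
      (fun x hx => (hφd x hx).mul (hd x).norm_sq) hDi]
    simp [ha, hb]
  have hi1 : IntervalIntegrable (fun x => ‖h x‖ ^ 2) volume a b :=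
    (hhc.norm.pow 2).intervalIntegrable _ _
  have hi2 : IntervalIntegrable (fun x => ‖h' x‖ ^ 2) volume a b :=
    (hc'.norm.pow 2).intervalIntegrable _ _
  have key : ∀ x, c ^ 2 * ‖h x‖ ^ 2 - c * D x ≤ ‖h' x‖ ^ 2 := by
    intro x
    have h1 := norm_add_sq_real (h' x) ((c * φ x) • h x)
    rw [norm_smul, real_inner_smul_right, mul_pow, Real.norm_eq_abs, sq_abs,
      real_inner_comm] at h1
    have h2 := sq_nonneg ‖h' x + (c * φ x) • h x‖
    simp only [hD]
    nlinarith
  calc c ^ 2 * ∫ x in a..b, ‖h x‖ ^ 2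
      = ∫ x in a..b, (c ^ 2 * ‖h x‖ ^ 2 - c * D x) := by
        rw [intervalIntegral.integral_sub (hi1.const_mul _) (hDi.const_mul _),
          intervalIntegral.integral_const_mul, intervalIntegral.integral_const_mul, hzero]
        ring
    _ ≤ _ := intervalIntegral.integral_mono_on hab ((hi1.const_mul _).sub (hDi.const_mul _)) hi2
        fun x _ => key x

theorem setLIntegral_enorm_sq_le_of_zeros {h h' : ℝ → ℂ} (hd : ∀ x, HasDerivAt h (h' x) x)
    (hc' : Continuous h') {a b c : ℝ} (hab : a ≤ b) (ha : h a = 0) (hb : h b = 0) (hc : 0 ≤ c)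
    (hcab : c * (b - a) < Real.pi) :
    ENNReal.ofReal (c ^ 2) * ∫⁻ x in Set.Ioc a b, ‖h x‖ₑ ^ 2 ≤
      ∫⁻ x in Set.Ioc a b, ‖h' x‖ₑ ^ 2 := by
  have hhc : Continuous h := continuous_iff_continuousAt.2 fun x => (hd x).continuousAt
  have conv : ∀ q : ℝ → ℂ, Continuous q →
      ∫⁻ x in Set.Ioc a b, ‖q x‖ₑ ^ 2 = ENNReal.ofReal (∫ x in a..b, ‖q x‖ ^ 2) := by
    intro q hq
    rw [intervalIntegral.integral_of_le hab, ofReal_integral_eq_lintegral_ofReal]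
    · refine lintegral_congr fun x => ?_
      rw [ENNReal.ofReal_pow (norm_nonneg _), ofReal_norm]
    · exact ((hq.norm.pow 2).intervalIntegrable a b).1
    · exact Eventually.of_forall fun x => by positivity
  rw [conv h hhc, conv h' hc', ← ENNReal.ofReal_mul (sq_nonneg c)]
  exact ENNReal.ofReal_le_ofReal (integral_norm_sq_le_of_zeros hd hc' hab ha hb hc hcab)

/-- If `𝓕 p` vanishes for `|ξ| ≤ κ` and at the points of a sequence whose gaps beyond `κ` are
shorter than `1 / (2 (R + 2))`, then the mass of `p` is controlled by its mass outside
`[-(R + 1), R + 1]`: Wirtinger's inequality for `𝓕 p` reads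
`(R + 2)² ∫ |p|² ≤ ∫ x² |p|²`, and the part `|x| ≤ R + 1` of the right-hand side is absorbed. -/
theorem lintegral_enorm_sq_le_tail {p : ℝ → ℂ} (hp1 : Integrable p) (hp2 : MemLp p 2)
    (hxp1 : Integrable fun x : ℝ => (x : ℂ) * p x) (hxp2 : MemLp (fun x : ℝ => (x : ℂ) * p x) 2)
    {a : ℤ → ℝ} (ha : IsOrderedSequence a) (hz : ∀ j, 𝓕 p (a j) = 0) {R κ : ℝ} (hR : 0 ≤ R)
    (hlow : ∀ ξ, |ξ| ≤ κ → 𝓕 p ξ = 0)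
    (hgap : ∀ j, ∀ ξ ∈ Set.Ioc (a j) (a (j + 1)), κ < |ξ| →
      (a (j + 1) - a j) * (2 * (R + 2)) < 1) :
    ∫⁻ ξ, ‖𝓕 p ξ‖ₑ ^ 2 ≤ ∫⁻ x in {x : ℝ | R + 1 < |x|}, ‖(x : ℂ) * p x‖ₑ ^ 2 := by
  have hs : MeasurableSet {x : ℝ | R + 1 < |x|} := measurableSet_lt measurable_const
    continuous_abs.measurable
  set u : ℝ → ℂ := fun x => (-2 * Real.pi * Complex.I) * ((x : ℂ) * p x) with hu
  have hu1 : Integrable u := hxp1.const_mul _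
  have hu2 : MemLp u 2 := hxp2.const_mul _
  have hd : ∀ ξ, HasDerivAt (𝓕 p) (𝓕 u ξ) ξ := by
    intro ξ
    convert! Real.hasDerivAt_fourier hp1 (by simpa using hxp1) ξ using 2
    ext x
    simp [hu, mul_assoc]
  have hW : ENNReal.ofReal ((2 * Real.pi * (R + 2)) ^ 2) * ∫⁻ ξ, ‖𝓕 p ξ‖ₑ ^ 2 ≤
      ∫⁻ ξ, ‖𝓕 u ξ‖ₑ ^ 2 := by
    rw [← lintegral_const_mul' _ _ ENNReal.ofReal_ne_top]
    refine ha.lintegral_le fun j => ?_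
    rw [lintegral_const_mul' _ _ ENNReal.ofReal_ne_top]
    by_cases hj : ∃ ξ ∈ Set.Ioc (a j) (a (j + 1)), κ < |ξ|
    · obtain ⟨ξ, hξ, hκ⟩ := hj
      refine setLIntegral_enorm_sq_le_of_zeros hd (Real.continuous_fourier_of_integrable hu1)
        (ha.1 (lt_add_one j)).le (hz _) (hz _) (by positivity) ?_
      have h1 := mul_lt_mul_of_pos_left (hgap j ξ hξ hκ) Real.pi_pos
      linarith
    · push Not at hj
      have : ∫⁻ ξ in Set.Ioc (a j) (a (j + 1)), ‖𝓕 p ξ‖ₑ ^ 2 = 0 := by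
        rw [setLIntegral_congr_fun measurableSet_Ioc (g := fun _ => 0)
          (fun ξ hξ => by simp [hlow ξ (hj ξ hξ)])]
        simp
      simp [this]
  rw [lintegral_enorm_fourier_sq hu1 hu2] at hW
  rw [lintegral_enorm_fourier_sq hp1 hp2] at hW ⊢
  set P := ∫⁻ x, ‖p x‖ₑ ^ 2 with hP
  set T := ∫⁻ x in {x : ℝ | R + 1 < |x|}, ‖(x : ℂ) * p x‖ₑ ^ 2 with hT
  have hPt : P ≠ ⊤ := by
    rw [hP, ← eLpNorm_two_sq]
    exact ENNReal.pow_ne_top hp2.eLpNorm_ne_top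
  have hsplit : ∫⁻ x : ℝ, ‖(x : ℂ) * p x‖ₑ ^ 2 ≤ T + ENNReal.ofReal ((R + 1) ^ 2) * P := by
    rw [← lintegral_add_compl _ hs]
    refine add_le_add le_rfl ?_
    rw [hP, ← lintegral_const_mul' _ _ ENNReal.ofReal_ne_top]
    refine (setLIntegral_mono' hs.compl fun x hx => ?_).trans (setLIntegral_le_lintegral _ _)
    rw [enorm_mul, mul_pow, ENNReal.ofReal_pow (by positivity)]
    gcongr
    rw [← ofReal_norm, Complex.norm_real, Real.norm_eq_abs]
    exact ENNReal.ofReal_le_ofReal (not_lt.1 hx)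
  have hu_eq : ∫⁻ x, ‖u x‖ₑ ^ 2 =
      ENNReal.ofReal ((2 * Real.pi) ^ 2) * ∫⁻ x : ℝ, ‖(x : ℂ) * p x‖ₑ ^ 2 := by
    rw [← lintegral_const_mul' _ _ ENNReal.ofReal_ne_top]
    refine lintegral_congr fun x => ?_
    rw [hu, enorm_mul, mul_pow, ENNReal.ofReal_pow (by positivity), ← ofReal_norm]
    simp [abs_of_pos Real.pi_pos]
  rw [hu_eq, mul_pow, ENNReal.ofReal_mul (by positivity), mul_assoc] at hW
  have hpi : ENNReal.ofReal ((2 * Real.pi) ^ 2) ≠ 0 := by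
    exact (ENNReal.ofReal_pos.2 (by positivity)).ne'
  rw [ENNReal.mul_le_mul_iff_right hpi ENNReal.ofReal_ne_top] at hW
  -- `(R + 2)² ≥ (R + 1)² + 1`, and the finite term `(R + 1)² P` cancels
  have h3 : ENNReal.ofReal ((R + 1) ^ 2) * P + P ≤ ENNReal.ofReal ((R + 1) ^ 2) * P + T := by
    calc _ = ENNReal.ofReal ((R + 1) ^ 2 + 1) * P := by
          rw [ENNReal.ofReal_add (by positivity) zero_le_one, ENNReal.ofReal_one, add_mul, one_mul]
      _ ≤ ENNReal.ofReal ((R + 2) ^ 2) * P := by gcongr; nlinarith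
      _ ≤ _ := hW.trans (hsplit.trans_eq (add_comm _ _))
  exact (ENNReal.add_le_add_iff_left (ENNReal.mul_ne_top ENNReal.ofReal_ne_top hPt)).1 h3

/-! ### Convolutions and the energy at high frequencies -/

/-- The function `(1 + |x|) |f(x)|`. -/
noncomputable def linearWeight (f : ℝ → ℂ) (x : ℝ) : ENNReal :=
  ENNReal.ofReal (1 + |x|) * ‖f x‖ₑ

theorem enorm_le_linearWeight (f : ℝ → ℂ) (x : ℝ) : ‖f x‖ₑ ≤ linearWeight f x := by
  refine le_mul_of_one_le_left' ?_
  rw [← ENNReal.ofReal_one]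
  exact ENNReal.ofReal_le_ofReal (by linarith [abs_nonneg x])

theorem enorm_mul_le_linearWeight (f : ℝ → ℂ) (x : ℝ) :
    ‖(x : ℂ) * f x‖ₑ ≤ linearWeight f x := by
  rw [enorm_mul, ← ofReal_norm, Complex.norm_real, Real.norm_eq_abs]
  exact mul_le_mul_left (ENNReal.ofReal_le_ofReal (by linarith [abs_nonneg x])) _

theorem measurable_linearWeight {f : ℝ → ℂ} (hf : Continuous f) :
    Measurable (linearWeight f) :=
  (by fun_prop : Measurable fun x : ℝ => ENNReal.ofReal (1 + |x|)).mul hf.enorm.measurable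

theorem memLp_two_of_lintegral {f : ℝ → ℂ} (hf : AEStronglyMeasurable f)
    (h : ∫⁻ x, ‖f x‖ₑ ^ 2 < ⊤) : MemLp f 2 := by
  refine ⟨hf, ?_⟩
  rw [← eLpNorm_two_sq] at h
  exact lt_top_iff_ne_top.2 fun h' => by simp [h'] at h

theorem integrable_of_linearWeight {f : ℝ → ℂ} (hf : AEStronglyMeasurable f)
    (h : ∫⁻ x, linearWeight f x < ⊤) :
    Integrable f ∧ Integrable fun x : ℝ => (x : ℂ) * f x :=
  ⟨⟨hf, (lintegral_mono (enorm_le_linearWeight f)).trans_lt h⟩,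
    ⟨Complex.continuous_ofReal.aestronglyMeasurable.mul hf,
      (lintegral_mono (enorm_mul_le_linearWeight f)).trans_lt h⟩⟩

theorem memLp_two_of_linearWeight {f : ℝ → ℂ} (hf : AEStronglyMeasurable f)
    (h : ∫⁻ x, linearWeight f x ^ 2 < ⊤) :
    MemLp f 2 ∧ MemLp (fun x : ℝ => (x : ℂ) * f x) 2 :=
  ⟨memLp_two_of_lintegral hf
    ((lintegral_mono fun x => pow_le_pow_left' (enorm_le_linearWeight f x) 2).trans_lt h),
    memLp_two_of_lintegral (Complex.continuous_ofReal.aestronglyMeasurable.mul hf)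
    ((lintegral_mono fun x => pow_le_pow_left' (enorm_mul_le_linearWeight f x) 2).trans_lt h)⟩

theorem lintegral_convolution_eq {k φ : ℝ → ENNReal} (hk : Measurable k) (hφ : Measurable φ) :
    ∫⁻ x, ∫⁻ t, k t * φ (x - t) = (∫⁻ t, k t) * ∫⁻ x, φ x := by
  rw [lintegral_lintegral_swap (by fun_prop)]
  rw [← lintegral_mul_const _ hk]
  refine lintegral_congr fun t => ?_
  rw [lintegral_const_mul _ (by fun_prop), lintegral_sub_right_eq_self φ]

theorem setLIntegral_convolution_sq_le {k φ : ℝ → ENNReal} (hk : Measurable k)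
    (hφ : Measurable φ) {s : Set ℝ} (hs : MeasurableSet s) :
    ∫⁻ x in s, (∫⁻ t, k t * φ (x - t)) ^ 2 ≤
      (∫⁻ t, k t) * ∫⁻ y, φ y ^ 2 * ∫⁻ t, k t * s.indicator 1 (y + t) := by
  have hind : Measurable (s.indicator (1 : ℝ → ENNReal)) := measurable_one.indicator hs
  calc ∫⁻ x in s, (∫⁻ t, k t * φ (x - t)) ^ 2
      ≤ ∫⁻ x in s, (∫⁻ t, k t) * ∫⁻ t, k t * φ (x - t) ^ 2 := lintegral_mono fun x =>
        ENNReal.lintegral_weight_mul_sq_le hk.aemeasurable (by fun_prop)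
    _ = (∫⁻ t, k t) * ∫⁻ x in s, ∫⁻ t, k t * φ (x - t) ^ 2 :=
        lintegral_const_mul _ (by fun_prop)
    _ = (∫⁻ t, k t) * ∫⁻ x, ∫⁻ t, k t * φ (x - t) ^ 2 * s.indicator 1 x := by
        rw [← lintegral_indicator hs]
        congr 1
        refine lintegral_congr fun x => ?_
        rw [lintegral_mul_const _ (by fun_prop)]
        by_cases hx : x ∈ s <;> simp [hx]
    _ = (∫⁻ t, k t) * ∫⁻ t, ∫⁻ x, k t * φ (x - t) ^ 2 * s.indicator 1 x := by
        rw [lintegral_lintegral_swap (by fun_prop)]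
    _ = (∫⁻ t, k t) * ∫⁻ t, ∫⁻ y, k t * φ y ^ 2 * s.indicator 1 (y + t) := by
        congr 1
        refine lintegral_congr fun t => ?_
        rw [← lintegral_sub_right_eq_self (fun y => k t * φ y ^ 2 * s.indicator 1 (y + t)) t]
        simp
    _ = (∫⁻ t, k t) * ∫⁻ y, ∫⁻ t, k t * φ y ^ 2 * s.indicator 1 (y + t) := by
        rw [lintegral_lintegral_swap (by fun_prop)]
    _ = _ := by
        congr 1
        refine lintegral_congr fun y => ?_
        rw [← lintegral_const_mul _ (by fun_prop)]
        refine lintegral_congr fun t => ?_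
        ring

theorem lintegral_convolution_sq_le {k φ : ℝ → ENNReal} (hk : Measurable k)
    (hφ : Measurable φ) :
    ∫⁻ x, (∫⁻ t, k t * φ (x - t)) ^ 2 ≤ (∫⁻ t, k t) * ((∫⁻ t, k t) * ∫⁻ y, φ y ^ 2) := by
  have h := setLIntegral_convolution_sq_le hk hφ MeasurableSet.univ
  simp only [setLIntegral_univ, Set.indicator_univ, Pi.one_apply, mul_one] at h
  rwa [lintegral_mul_const _ (by fun_prop), mul_comm (∫⁻ y, φ y ^ 2)] at h

/-- The part of a convolution far out comes from the part of `φ` far out, up to the mass of the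
kernel away from the origin. -/
theorem setLIntegral_tail_convolution_sq_le {k φ : ℝ → ENNReal} (hk : Measurable k)
    (hφ : Measurable φ) (R : ℝ) :
    ∫⁻ x in {x : ℝ | R + 1 < |x|}, (∫⁻ t, k t * φ (x - t)) ^ 2 ≤
      (∫⁻ t, k t) * ((∫⁻ t, k t) * (∫⁻ y in {y : ℝ | R < |y|}, φ y ^ 2) +
        (∫⁻ t in {t : ℝ | 1 < |t|}, k t) * ∫⁻ y, φ y ^ 2) := by
  have hs : ∀ r : ℝ, MeasurableSet {x : ℝ | r < |x|} := fun r => measurableSet_lt measurable_const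
    continuous_abs.measurable
  refine (setLIntegral_convolution_sq_le hk hφ (hs _)).trans ?_
  gcongr
  rw [← lintegral_indicator (hs R), ← lintegral_const_mul _ ((hφ.pow_const 2).indicator (hs R)),
    ← lintegral_const_mul _ (hφ.pow_const 2), ← lintegral_add_left
    (((hφ.pow_const 2).indicator (hs R)).const_mul _)]
  refine lintegral_mono fun y => ?_
  by_cases hy : R < |y|
  · rw [Set.indicator_of_mem (show y ∈ {y : ℝ | R < |y|} from hy), mul_comm]
    refine le_add_right (mul_le_mul_left (lintegral_mono fun t => ?_) _)
    refine mul_le_of_le_one_right' (Set.indicator_le_self' (by simp) _)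
  · rw [mul_comm]
    refine le_add_left (mul_le_mul_left ?_ _)
    rw [← lintegral_indicator (hs 1)]
    refine lintegral_mono fun t => ?_
    by_cases ht : y + t ∈ {x : ℝ | R + 1 < |x|}
    · have ht1 : t ∈ {t : ℝ | 1 < |t|} := by
        have h1 := abs_add_le y t
        simp only [Set.mem_ofPred_eq] at ht ⊢
        linarith
      simp [Set.indicator_of_mem ht, Set.indicator_of_mem ht1]
    · simp [Set.indicator_of_notMem ht]

theorem linearWeight_convolution_le (Q f : ℝ → ℂ) (x : ℝ) :
    linearWeight (fun x => ∫ t, Q t * f (x - t)) x ≤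
      ∫⁻ t, linearWeight Q t * linearWeight f (x - t) := by
  simp only [linearWeight]
  calc _ ≤ ENNReal.ofReal (1 + |x|) * ∫⁻ t, ‖Q t * f (x - t)‖ₑ := by
        gcongr; exact enorm_integral_le_lintegral_enorm _
    _ = ∫⁻ t, ENNReal.ofReal (1 + |x|) * ‖Q t * f (x - t)‖ₑ :=
        (lintegral_const_mul' _ _ ENNReal.ofReal_ne_top).symm
    _ ≤ _ := by
        refine lintegral_mono fun t => ?_
        have h : ENNReal.ofReal (1 + |x|) ≤
            ENNReal.ofReal (1 + |t|) * ENNReal.ofReal (1 + |x - t|) := by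
          rw [← ENNReal.ofReal_mul (by positivity)]
          refine ENNReal.ofReal_le_ofReal ?_
          have h1 := abs_add_le t (x - t)
          rw [add_sub_cancel] at h1
          nlinarith [mul_nonneg (abs_nonneg t) (abs_nonneg (x - t))]
        rw [enorm_mul]
        calc _ ≤ ENNReal.ofReal (1 + |t|) * ENNReal.ofReal (1 + |x - t|) *
                (‖Q t‖ₑ * ‖f (x - t)‖ₑ) :=
              mul_le_mul_left h _
          _ = _ := by ring

theorem ENNReal.add_sq_le_two_mul (a b : ENNReal) : (a + b) ^ 2 ≤ 2 * a ^ 2 + 2 * b ^ 2 := by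
  have := ENNReal.rpow_add_le_mul_rpow_add_rpow a b (p := 2) (by norm_num)
  norm_num at this
  rw [← mul_add]
  exact this

open Convolution in
/-- If the multiplier `𝓕 Q` is `1` for `|ξ| ≤ κ` and `0` for `|ξ| ≥ K`, and `𝓕 f` vanishes at the
points of a sequence whose gaps beyond `κ` are shorter than `1 / (2 (R + 2))`, then the energy of
`f` at frequencies above `K` is controlled by the mass of `f` outside `[-R, R]`, up to the tail
of `Q`. -/
theorem setLIntegral_high_frequency_le {f Q : ℝ → ℂ} (hf : Continuous f) (hQ : Continuous Q)
    (hf1 : ∫⁻ x, linearWeight f x < ⊤) (hf2 : ∫⁻ x, linearWeight f x ^ 2 < ⊤)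
    (hQ1 : ∫⁻ t, linearWeight Q t < ⊤) {a : ℤ → ℝ} (ha : IsOrderedSequence a)
    (hz : ∀ j, 𝓕 f (a j) = 0) {R κ K : ℝ} (hR : 0 ≤ R) (hlow : ∀ ξ, |ξ| ≤ κ → 𝓕 Q ξ = 1)
    (hhigh : ∀ ξ, K ≤ |ξ| → 𝓕 Q ξ = 0)
    (hgap : ∀ j, ∀ ξ ∈ Set.Ioc (a j) (a (j + 1)), κ < |ξ| →
      (a (j + 1) - a j) * (2 * (R + 2)) < 1) :
    ∫⁻ ξ in {ξ : ℝ | K ≤ |ξ|}, ‖𝓕 f ξ‖ₑ ^ 2 ≤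
      2 * (∫⁻ x in {x : ℝ | R < |x|}, linearWeight f x ^ 2) +
      2 * ((∫⁻ t, linearWeight Q t) *
        ((∫⁻ t, linearWeight Q t) * (∫⁻ x in {x : ℝ | R < |x|}, linearWeight f x ^ 2) +
        (∫⁻ t in {t : ℝ | 1 < |t|}, linearWeight Q t) * ∫⁻ x, linearWeight f x ^ 2)) := by
  have hkm := measurable_linearWeight hQ
  have hφm := measurable_linearWeight hf
  obtain ⟨hfi, -⟩ := integrable_of_linearWeight hf.aestronglyMeasurable hf1
  obtain ⟨hQi, -⟩ := integrable_of_linearWeight hQ.aestronglyMeasurable hQ1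
  set c : ℝ → ℂ := fun x => ∫ t, Q t * f (x - t) with hc
  have hci : Integrable c := hQi.integrable_convolution (ContinuousLinearMap.mul ℂ ℂ) hfi
  set p : ℝ → ℂ := fun x => f x - c x with hp
  have hpm : AEStronglyMeasurable p := (hfi.sub hci).1
  set V : ℝ → ENNReal := fun x => ∫⁻ t, linearWeight Q t * linearWeight f (x - t) with hV
  have hVm : Measurable V := by
    have : Measurable (Function.uncurry fun x t : ℝ => linearWeight Q t * linearWeight f (x - t)) :=
      by fun_prop
    exact this.lintegral_prod_right'
  have hpw : ∀ x, linearWeight p x ≤ linearWeight f x + V x := by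
    intro x
    calc linearWeight p x ≤ ENNReal.ofReal (1 + |x|) * (‖f x‖ₑ + ‖c x‖ₑ) := by
          simp only [linearWeight, hp]; gcongr; exact enorm_sub_le
      _ = linearWeight f x + linearWeight c x := by rw [mul_add]; rfl
      _ ≤ _ := by gcongr; exact linearWeight_convolution_le Q f x
  have hp1 : ∫⁻ x, linearWeight p x < ⊤ := by
    refine (lintegral_mono hpw).trans_lt ?_
    rw [lintegral_add_left hφm, lintegral_convolution_eq hkm hφm]
    exact ENNReal.add_lt_top.2 ⟨hf1, ENNReal.mul_lt_top hQ1 hf1⟩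
  have hsq : ∀ s : Set ℝ, ∫⁻ x in s, linearWeight p x ^ 2 ≤
      2 * (∫⁻ x in s, linearWeight f x ^ 2) + 2 * ∫⁻ x in s, V x ^ 2 := by
    intro s
    rw [← lintegral_const_mul _ (hφm.pow_const 2), ← lintegral_const_mul _ (hVm.pow_const 2),
      ← lintegral_add_left ((hφm.pow_const 2).const_mul 2)]
    exact lintegral_mono fun x =>
      (pow_le_pow_left' (hpw x) 2).trans (ENNReal.add_sq_le_two_mul _ _)
  have hp2 : ∫⁻ x, linearWeight p x ^ 2 < ⊤ := by
    rw [← setLIntegral_univ]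
    refine (hsq _).trans_lt ?_
    simp only [setLIntegral_univ]
    refine ENNReal.add_lt_top.2 ⟨ENNReal.mul_lt_top (by simp) hf2,
      ENNReal.mul_lt_top (by simp) ((lintegral_convolution_sq_le hkm hφm).trans_lt ?_)⟩
    exact ENNReal.mul_lt_top hQ1 (ENNReal.mul_lt_top hQ1 hf2)
  have hFp : ∀ ξ, 𝓕 p ξ = (1 - 𝓕 Q ξ) * 𝓕 f ξ := by
    intro ξ
    have h1 : 𝓕 p ξ = 𝓕 f ξ - 𝓕 c ξ := by
      simp only [Real.fourier_eq, hp, smul_sub]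
      exact integral_sub ((Real.fourierIntegral_convergent_iff ξ).2 hfi)
        ((Real.fourierIntegral_convergent_iff ξ).2 hci)
    have h2 : 𝓕 c ξ = 𝓕 Q ξ * 𝓕 f ξ := Real.fourier_mul_convolution_eq hQi hfi ξ
    rw [h1, h2]; ring
  obtain ⟨hpi, hxpi⟩ := integrable_of_linearWeight hpm hp1
  obtain ⟨hpL, hxpL⟩ := memLp_two_of_linearWeight hpm hp2
  have hsK : MeasurableSet {ξ : ℝ | K ≤ |ξ|} := measurableSet_le measurable_const
    continuous_abs.measurable
  calc ∫⁻ ξ in {ξ : ℝ | K ≤ |ξ|}, ‖𝓕 f ξ‖ₑ ^ 2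
      = ∫⁻ ξ in {ξ : ℝ | K ≤ |ξ|}, ‖𝓕 p ξ‖ₑ ^ 2 :=
        setLIntegral_congr_fun hsK fun ξ hξ => by simp [hFp, hhigh ξ hξ]
    _ ≤ ∫⁻ ξ, ‖𝓕 p ξ‖ₑ ^ 2 := setLIntegral_le_lintegral _ _
    _ ≤ ∫⁻ x in {x : ℝ | R + 1 < |x|}, ‖(x : ℂ) * p x‖ₑ ^ 2 :=
        lintegral_enorm_sq_le_tail hpi hpL hxpi hxpL ha (fun j => by rw [hFp, hz, mul_zero]) hR
          (fun ξ hξ => by rw [hFp, hlow ξ hξ]; ring) hgap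
    _ ≤ ∫⁻ x in {x : ℝ | R + 1 < |x|}, linearWeight p x ^ 2 :=
        lintegral_mono fun x => pow_le_pow_left' (enorm_mul_le_linearWeight p x) 2
    _ ≤ _ := hsq _
    _ ≤ _ := by
        refine add_le_add (mul_le_mul_right (lintegral_mono_set fun x hx => ?_) _)
          (mul_le_mul_right (setLIntegral_tail_convolution_sq_le hkm hφm R) _)
        simp only [Set.mem_ofPred_eq] at hx ⊢
        linarith

/-! ### Summation over dyadic frequencies -/

/-- A rapidly decreasing kernel whose multiplier is `1` for `|ξ| ≤ 1/2` and `0` for `|ξ| ≥ 1`. -/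
theorem exists_frequency_cutoff : ∃ Θ : ℝ → ℂ, Continuous Θ ∧
    ∫⁻ u, ENNReal.ofReal ((1 + |u|) ^ 4) * ‖Θ u‖ₑ < ⊤ ∧
    (∀ ξ, |ξ| ≤ 1 / 2 → 𝓕 Θ ξ = 1) ∧ ∀ ξ, 1 ≤ |ξ| → 𝓕 Θ ξ = 0 := by
  let b : ContDiffBump (0 : ℝ) := ⟨1 / 2, 1, by norm_num, by norm_num⟩
  have h1 : ContDiff ℝ (⊤ : ℕ∞) (fun x => (b x : ℂ)) := Complex.ofRealCLM.contDiff.comp b.contDiff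
  have h2 : HasCompactSupport (fun x => (b x : ℂ)) :=
    b.hasCompactSupport.comp_left (g := fun t : ℝ => (t : ℂ)) (by simp)
  set S : SchwartzMap ℝ ℂ := h2.toSchwartzMap h1 with hS
  have hF : ∀ ξ, 𝓕 ((𝓕⁻ S : SchwartzMap ℝ ℂ) : ℝ → ℂ) ξ = (b ξ : ℂ) := by
    intro ξ
    rw [← SchwartzMap.fourier_coe, FourierTransform.fourier_fourierInv_eq]
    rfl
  refine ⟨(𝓕⁻ S : SchwartzMap ℝ ℂ), (𝓕⁻ S).continuous, ?_, fun ξ hξ => ?_, fun ξ hξ => ?_⟩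
  · set T : SchwartzMap ℝ ℂ := 𝓕⁻ S with hT
    have hi : Integrable fun u : ℝ => 8 * ‖T u‖ + 8 * (‖u‖ ^ 4 * ‖T u‖) :=
      (T.integrable.norm.const_mul 8).add ((T.integrable_pow_mul volume 4).const_mul 8)
    refine (lintegral_mono fun u => ?_).trans_lt hi.lintegral_lt_top
    rw [← ofReal_norm, ← ENNReal.ofReal_mul (by positivity)]
    refine ENNReal.ofReal_le_ofReal ?_
    have h : (1 + |u|) ^ 4 ≤ 8 + 8 * ‖u‖ ^ 4 := by
      rw [Real.norm_eq_abs]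
      nlinarith [sq_nonneg (1 - |u|), sq_nonneg (1 - |u| ^ 2), sq_nonneg (|u| - |u| ^ 2),
        abs_nonneg u]
    nlinarith [norm_nonneg (T u), mul_le_mul_of_nonneg_right h (norm_nonneg (T u))]
  · rw [hF, b.one_of_mem_closedBall (by simpa [b] using hξ)]
    simp
  · rw [hF, b.zero_of_le_dist (by simpa [b] using hξ)]
    simp

theorem lintegral_comp_const_mul {K : ℝ} (hK : 0 < K) (F : ℝ → ENNReal) (hF : Measurable F) :
    ∫⁻ t, ENNReal.ofReal K * F (K * t) = ∫⁻ u, F u := by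
  rw [lintegral_const_mul _ (by fun_prop),
    ← lintegral_map hF (measurable_const_mul K), Real.map_volume_mul_left hK.ne',
    lintegral_smul_measure, smul_eq_mul, ← mul_assoc, ← ENNReal.ofReal_mul hK.le,
    abs_of_pos (inv_pos.2 hK), mul_inv_cancel₀ hK.ne', ENNReal.ofReal_one, one_mul]

theorem fourier_dilation {Θ : ℝ → ℂ} {K : ℝ} (hK : 0 < K) (ξ : ℝ) :
    𝓕 (fun t => (K : ℂ) * Θ (K * t)) ξ = 𝓕 Θ (ξ / K) := by
  rw [Real.fourier_real_eq, Real.fourier_real_eq]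
  have h := Measure.integral_comp_mul_left (fun u => Real.fourierChar (-(u * (ξ / K))) • Θ u) K
  rw [abs_of_pos (inv_pos.2 hK)] at h
  have e : ∀ t : ℝ, Real.fourierChar (-(t * ξ)) • ((K : ℂ) * Θ (K * t)) =
      K • (Real.fourierChar (-(K * t * (ξ / K))) • Θ (K * t)) := by
    intro t
    rw [show K * t * (ξ / K) = t * ξ by field_simp, smul_comm K]
    simp
  simp_rw [e]
  rw [integral_smul, h, smul_smul, mul_inv_cancel₀ hK.ne', one_smul]

/-- The masses of the dilated kernels `K Θ(K t)` are bounded uniformly in `K ≥ 1`. -/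
theorem lintegral_linearWeight_dilation_le {Θ : ℝ → ℂ} (hΘ : Continuous Θ) {K : ℝ} (hK : 1 ≤ K) :
    ∫⁻ t, linearWeight (fun t => (K : ℂ) * Θ (K * t)) t ≤
      ∫⁻ u, ENNReal.ofReal ((1 + |u|) ^ 4) * ‖Θ u‖ₑ := by
  have hK0 : 0 < K := by linarith
  have hm : Measurable fun u : ℝ => ENNReal.ofReal ((1 + |u|) ^ 4) * ‖Θ u‖ₑ :=
    (by fun_prop : Measurable fun u : ℝ => ENNReal.ofReal ((1 + |u|) ^ 4)).mul
      hΘ.enorm.measurable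
  rw [← lintegral_comp_const_mul hK0 _ hm]
  refine lintegral_mono fun t => ?_
  simp only [linearWeight]
  rw [enorm_mul, ← ofReal_norm (K : ℂ), Complex.norm_real, Real.norm_of_nonneg hK0.le,
    mul_left_comm]
  gcongr
  rw [abs_mul, abs_of_pos hK0]
  have h1 : |t| ≤ K * |t| := le_mul_of_one_le_left (abs_nonneg t) hK
  calc 1 + |t| ≤ 1 + K * |t| := by linarith
    _ ≤ _ := le_self_pow₀ (by linarith [abs_nonneg t]) (by norm_num)

/-- The mass of `K Θ(K t)` away from the origin is `O(K⁻³)`. The third power outweighs the factor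
`K²` that each dyadic frequency contributes to the energy. -/
theorem setLIntegral_linearWeight_dilation_le {Θ : ℝ → ℂ} (hΘ : Continuous Θ) {K : ℝ}
    (hK : 1 ≤ K) :
    ∫⁻ t in {t : ℝ | 1 < |t|}, linearWeight (fun t => (K : ℂ) * Θ (K * t)) t ≤
      ENNReal.ofReal ((K ^ 3)⁻¹) * ∫⁻ u, ENNReal.ofReal ((1 + |u|) ^ 4) * ‖Θ u‖ₑ := by
  have hK0 : 0 < K := by linarith
  have hm : Measurable fun u : ℝ => ENNReal.ofReal ((1 + |u|) ^ 4) * ‖Θ u‖ₑ :=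
    (by fun_prop : Measurable fun u : ℝ => ENNReal.ofReal ((1 + |u|) ^ 4)).mul
      hΘ.enorm.measurable
  rw [← lintegral_comp_const_mul hK0 _ hm, ← lintegral_const_mul' _ _ ENNReal.ofReal_ne_top]
  refine (setLIntegral_mono' (measurableSet_lt measurable_const
    continuous_abs.measurable) fun t ht => ?_).trans (setLIntegral_le_lintegral _ _)
  simp only [linearWeight]
  rw [enorm_mul, ← ofReal_norm (K : ℂ), Complex.norm_real, Real.norm_of_nonneg hK0.le,
    mul_left_comm, mul_left_comm (ENNReal.ofReal ((K ^ 3)⁻¹)),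
    ← mul_assoc (ENNReal.ofReal ((K ^ 3)⁻¹)),
    ← ENNReal.ofReal_mul (by positivity)]
  gcongr
  rw [abs_mul, abs_of_pos hK0, inv_mul_eq_div, le_div_iff₀ (by positivity)]
  have ht1 : 1 < |t| := ht
  have h1 : |t| ≤ K * |t| := le_mul_of_one_le_left (abs_nonneg t) hK
  have h2 : K ≤ 1 + K * |t| := by nlinarith
  calc (1 + |t|) * K ^ 3 ≤ (1 + K * |t|) * (1 + K * |t|) ^ 3 := by gcongr
    _ = _ := by ring

/-- The density of zeros used on the frequency side, for `x ≥ 0`. Its values at `x ≥ K / 2` exceed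
`2 (R + 2)` with `R = (log K / (4π)) ^ (1 / s)`, as `lintegral_enorm_sq_le_tail` requires when the
cutoff begins at half the frequency `K`. -/
noncomputable def frequencyDensity (s x : ℝ) : ℝ :=
  2 * (Real.log (1 + 2 * x) / (4 * Real.pi)) ^ (1 / s) + 5

/-- The weight `(1 + x²) exp (4π |x|^s)` on the space side. -/
noncomputable def spaceWeight (s x : ℝ) : ℝ :=
  (1 + x ^ 2) * Real.exp (4 * Real.pi * |x| ^ s)

theorem one_add_sq_le_spaceWeight (s x : ℝ) : 1 + x ^ 2 ≤ spaceWeight s x :=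
  le_mul_of_one_le_right (by positivity) (Real.one_le_exp (by positivity))

theorem sum_four_pow_le (n : ℕ) :
    ∑ j ∈ Finset.range (n + 1), (4 : ENNReal) ^ (j + 1) ≤ 6 * 4 ^ n := by
  have h : ∑ j ∈ Finset.range (n + 1), 4 ^ (j + 1) ≤ 6 * 4 ^ n := by
    induction n with
    | zero => simp
    | succ n ih =>
      rw [Finset.sum_range_succ, pow_succ 4 n]
      rw [pow_succ 4 (n + 1), pow_succ]
      omega
  exact_mod_cast h

theorem tsum_dyadic_le {Y : ℝ} (hY : 1 ≤ Y) :
    ∑' j : ℕ, (if (2 : ℝ) ^ j < Y then (4 : ENNReal) ^ (j + 1) else 0) ≤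
      6 * ENNReal.ofReal (Y ^ 2) := by
  obtain ⟨n, hn, hn'⟩ := exists_nat_pow_near hY (one_lt_two)
  rw [tsum_eq_sum (s := Finset.range (n + 1))]
  · calc _ ≤ ∑ j ∈ Finset.range (n + 1), (4 : ENNReal) ^ (j + 1) :=
          Finset.sum_le_sum fun j _ => by split_ifs <;> simp
      _ ≤ 6 * 4 ^ n := sum_four_pow_le n
      _ = 6 * ENNReal.ofReal ((2 ^ n) ^ 2) := by
          rw [← pow_mul, mul_comm n, pow_mul, ENNReal.ofReal_pow (by norm_num)]; norm_num
      _ ≤ _ := by gcongr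
  · intro j hj
    have hj' : n + 1 ≤ j := by simpa using hj
    have : Y ≤ 2 ^ j := hn'.le.trans (pow_le_pow_right₀ (by norm_num) hj')
    simp [not_lt.2 this]

theorem sq_le_one_add_tsum_dyadic (ξ : ℝ) :
    ENNReal.ofReal (ξ ^ 2) ≤
      1 + ∑' j : ℕ, (4 : ENNReal) ^ (j + 1) * {ξ : ℝ | 2 ^ j ≤ |ξ|}.indicator 1 ξ := by
  rcases le_or_gt 1 |ξ| with h | h
  · obtain ⟨n, hn, hn'⟩ := exists_nat_pow_near h (one_lt_two)
    refine le_add_left (le_trans ?_ (ENNReal.le_tsum n))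
    rw [Set.indicator_of_mem (show ξ ∈ {ξ : ℝ | 2 ^ n ≤ |ξ|} from hn), Pi.one_apply, mul_one]
    calc ENNReal.ofReal (ξ ^ 2) ≤ ENNReal.ofReal ((2 ^ (n + 1)) ^ 2) := by
          rw [← sq_abs]; gcongr
      _ = 4 ^ (n + 1) := by
          rw [← pow_mul, mul_comm (n + 1), pow_mul, ENNReal.ofReal_pow (by norm_num)]; norm_num
  · refine le_add_right ?_
    rw [← ENNReal.ofReal_one, ← sq_abs]
    exact ENNReal.ofReal_le_ofReal (pow_le_one₀ (abs_nonneg _) h.le)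

theorem linearWeight_sq_le (f : ℝ → ℂ) (x : ℝ) :
    linearWeight f x ^ 2 ≤ 2 * (ENNReal.ofReal (1 + x ^ 2) * ‖f x‖ₑ ^ 2) := by
  rw [linearWeight, mul_pow, ← mul_assoc, ← ENNReal.ofReal_pow (by positivity)]
  gcongr
  rw [← ENNReal.ofReal_ofNat 2, ← ENNReal.ofReal_mul (by norm_num)]
  refine ENNReal.ofReal_le_ofReal ?_
  nlinarith [sq_nonneg (1 - |x|), sq_abs x]

/-- Finiteness of the weighted norm makes `x f(x)` integrable, so that `𝓕 f` is differentiable. -/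
theorem lintegral_linearWeight_lt_top (s : ℝ) {f : ℝ → ℂ}
    (hF : ∫⁻ x, ENNReal.ofReal (spaceWeight s x) ^ 2 * ‖f x‖ₑ ^ 2 < ⊤) :
    ∫⁻ x, linearWeight f x < ⊤ := by
  have h2 : ∫⁻ x : ℝ, ENNReal.ofReal (2 * (1 + x ^ 2)⁻¹) < ⊤ :=
    (integrable_inv_one_add_sq.const_mul 2).lintegral_lt_top
  refine lt_of_le_of_lt ?_ (ENNReal.add_lt_top.2 ⟨hF, h2⟩)
  rw [← lintegral_add_right _ (by fun_prop)]
  refine lintegral_mono fun x => ?_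
  rw [linearWeight, ← ofReal_norm, ← ENNReal.ofReal_mul (by positivity), ← mul_pow,
    ← ENNReal.ofReal_mul (by unfold spaceWeight; positivity),
    ← ENNReal.ofReal_pow (by unfold spaceWeight; positivity),
    ← ENNReal.ofReal_add (by positivity) (by positivity)]
  refine ENNReal.ofReal_le_ofReal ?_
  have hy := norm_nonneg (f x)
  have hx : 0 < 1 + x ^ 2 := by positivity
  have h1 : ((1 + x ^ 2) * ‖f x‖) ^ 2 ≤ (spaceWeight s x * ‖f x‖) ^ 2 := by
    gcongr; exact one_add_sq_le_spaceWeight s x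
  have h3 : (1 + |x|) ^ 2 * ((1 + x ^ 2)⁻¹) ^ 2 ≤ 2 * (1 + x ^ 2)⁻¹ := by
    have : (1 + |x|) ^ 2 ≤ 2 * (1 + x ^ 2) := by nlinarith [sq_nonneg (1 - |x|), sq_abs x]
    calc _ ≤ 2 * (1 + x ^ 2) * ((1 + x ^ 2)⁻¹) ^ 2 := by gcongr
      _ = _ := by field_simp
  have h4 : (1 + |x|) * ‖f x‖ = ((1 + x ^ 2) * ‖f x‖) * ((1 + |x|) * (1 + x ^ 2)⁻¹) := by
    field_simp
  have h5 := sq_nonneg ((1 + x ^ 2) * ‖f x‖ - (1 + |x|) * (1 + x ^ 2)⁻¹)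
  have h6 : 0 ≤ ((1 + x ^ 2) * ‖f x‖) * ((1 + |x|) * (1 + x ^ 2)⁻¹) := by positivity
  nlinarith

/-- The frequency side: zeros of `𝓕 f` with density `frequencyDensity` bound the energy of `f` by
a weighted norm on the space side. Frequencies of size `2 ^ j` are estimated with the radius
`R = (log 2 ^ j / (4π)) ^ (1 / s)`, for which `R < |x|` means `2 ^ j < exp (4π |x| ^ s)`; this is
where the exponential weight comes from. -/
theorem exists_lintegral_sq_mul_fourier_le : ∃ C : ENNReal, C ≠ ⊤ ∧
    ∀ {s : ℝ}, 0 < s → ∀ {f : ℝ → ℂ}, Continuous f →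
    ∫⁻ x, ENNReal.ofReal (spaceWeight s x) ^ 2 * ‖f x‖ₑ ^ 2 < ⊤ →
    ∀ {a : ℤ → ℝ}, IsOrderedSequence a → (∀ j, 𝓕 f (a j) = 0) →
    (∀ j, ∀ ξ ∈ Set.Icc (a j) (a (j + 1)), (a (j + 1) - a j) * frequencyDensity s |ξ| ≤ 1) →
    ∫⁻ ξ, ENNReal.ofReal (ξ ^ 2) * ‖𝓕 f ξ‖ₑ ^ 2 ≤
      C * ∫⁻ x, ENNReal.ofReal (spaceWeight s x) ^ 2 * ‖f x‖ₑ ^ 2 := by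
  obtain ⟨Θ, hΘ, hA, hΘ1, hΘ0⟩ := exists_frequency_cutoff
  set A := ∫⁻ u, ENNReal.ofReal ((1 + |u|) ^ 4) * ‖Θ u‖ₑ with hAdef
  refine ⟨1 + 12 * (2 + 2 * (A * A)) + 32 * (A * A), ?_, ?_⟩
  · have : A * A ≠ ⊤ := ENNReal.mul_ne_top hA.ne hA.ne
    finiteness
  intro s hs f hf hF a ha hz hgap
  set F := ∫⁻ x, ENNReal.ofReal (spaceWeight s x) ^ 2 * ‖f x‖ₑ ^ 2 with hFdef
  have hφm := measurable_linearWeight hf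
  have hw : ∀ x, 0 ≤ spaceWeight s x := fun x => by unfold spaceWeight; positivity
  have hwt : ∀ x, ENNReal.ofReal (1 + x ^ 2) * ENNReal.ofReal (Real.exp (4 * Real.pi * |x| ^ s) ^ 2)
      ≤ ENNReal.ofReal (spaceWeight s x) ^ 2 := by
    intro x
    rw [← ENNReal.ofReal_pow (hw x), ← ENNReal.ofReal_mul (by positivity)]
    refine ENNReal.ofReal_le_ofReal ?_
    rw [spaceWeight, mul_pow]
    gcongr
    exact le_self_pow₀ (by nlinarith [sq_nonneg x]) (by norm_num)
  have hwt1 : ∀ x, ENNReal.ofReal (1 + x ^ 2) ≤ ENNReal.ofReal (spaceWeight s x) ^ 2 := by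
    intro x
    refine le_trans (le_mul_of_one_le_right' ?_) (hwt x)
    rw [← ENNReal.ofReal_one]
    exact ENNReal.ofReal_le_ofReal (one_le_pow₀ (Real.one_le_exp (by positivity)))
  have hΦ : ∫⁻ x, linearWeight f x ^ 2 ≤ 2 * F := by
    rw [hFdef, ← lintegral_const_mul' _ _ (by simp)]
    refine lintegral_mono fun x => (linearWeight_sq_le f x).trans ?_
    gcongr
    exact hwt1 x
  have hf1 := lintegral_linearWeight_lt_top s hF
  have hf2 : ∫⁻ x, linearWeight f x ^ 2 < ⊤ := hΦ.trans_lt (ENNReal.mul_lt_top (by simp) hF)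
  obtain ⟨hfi, -⟩ := integrable_of_linearWeight hf.aestronglyMeasurable hf1
  obtain ⟨hfL, -⟩ := memLp_two_of_linearWeight hf.aestronglyMeasurable hf2
  have hgc := Real.continuous_fourier_of_integrable hfi
  set R : ℕ → ℝ := fun j => (Real.log (2 ^ j) / (4 * Real.pi)) ^ (1 / s) with hRdef
  have hlog : ∀ j : ℕ, 0 ≤ Real.log (2 ^ j) / (4 * Real.pi) := fun j =>
    div_nonneg (Real.log_nonneg (one_le_pow₀ (by norm_num))) (by positivity)
  -- the estimate above the single frequency `2 ^ j`
  have hscale : ∀ j : ℕ, ∫⁻ ξ in {ξ : ℝ | 2 ^ j ≤ |ξ|}, ‖𝓕 f ξ‖ₑ ^ 2 ≤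
      (2 + 2 * (A * A)) * (∫⁻ x in {x : ℝ | R j < |x|}, linearWeight f x ^ 2) +
      2 * (A * A) * (8⁻¹ ^ j * (2 * F)) := by
    intro j
    have hK : (1 : ℝ) ≤ 2 ^ j := one_le_pow₀ (by norm_num)
    have hK0 : (0 : ℝ) < 2 ^ j := by positivity
    have hQ1 := lintegral_linearWeight_dilation_le hΘ hK
    have hQ2 := setLIntegral_linearWeight_dilation_le hΘ hK
    have h := setLIntegral_high_frequency_le (Q := fun t => ((2 ^ j : ℝ) : ℂ) * Θ (2 ^ j * t))
      (R := R j) (κ := 2 ^ j / 2) (K := 2 ^ j) hf (by fun_prop) hf1 hf2 (hQ1.trans_lt hA) ha hz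
      (Real.rpow_nonneg (hlog j) _) ?_ ?_ ?_
    · refine h.trans ?_
      have e8 : ENNReal.ofReal (((2 ^ j : ℝ) ^ 3)⁻¹) = 8⁻¹ ^ j := by
        rw [← pow_mul, mul_comm j, pow_mul, ENNReal.ofReal_inv_of_pos (by positivity),
          ENNReal.ofReal_pow (by norm_num), ENNReal.inv_pow]
        norm_num
      rw [e8] at hQ2
      set T := ∫⁻ x in {x : ℝ | R j < |x|}, linearWeight f x ^ 2
      calc _ ≤ 2 * T + 2 * (A * (A * T + (8⁻¹ ^ j * A) * (2 * F))) := by gcongr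
        _ = _ := by ring
    · intro ξ hξ
      rw [fourier_dilation hK0]
      apply hΘ1
      rw [abs_div, abs_of_pos hK0, div_le_iff₀ hK0]
      linarith
    · intro ξ hξ
      rw [fourier_dilation hK0]
      apply hΘ0
      rw [abs_div, abs_of_pos hK0, le_div_iff₀ hK0]
      linarith
    · intro i ξ hξ hlt
      have hpos : 0 < a (i + 1) - a i := sub_pos.2 (ha.1 (lt_add_one i))
      refine lt_of_lt_of_le ?_ (hgap i ξ (Set.Ioc_subset_Icc_self hξ))
      refine mul_lt_mul_of_pos_left ?_ hpos
      have : R j ≤ (Real.log (1 + 2 * |ξ|) / (4 * Real.pi)) ^ (1 / s) := by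
        refine Real.rpow_le_rpow (hlog j) ?_ (by positivity)
        gcongr
        linarith
      unfold frequencyDensity
      linarith
  have hm : ∀ j : ℕ, MeasurableSet {ξ : ℝ | 2 ^ j ≤ |ξ|} := fun j =>
    measurableSet_le measurable_const continuous_abs.measurable
  have hm' : ∀ j : ℕ, MeasurableSet {x : ℝ | R j < |x|} := fun j =>
    measurableSet_lt measurable_const continuous_abs.measurable
  have hgm : Measurable fun ξ => ‖𝓕 f ξ‖ₑ ^ 2 := hgc.enorm.measurable.pow_const 2
  -- layer-cake decomposition of `ξ²` over dyadic frequencies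
  have hsplit : ∫⁻ ξ, ENNReal.ofReal (ξ ^ 2) * ‖𝓕 f ξ‖ₑ ^ 2 ≤ (∫⁻ ξ, ‖𝓕 f ξ‖ₑ ^ 2) +
      ∑' j : ℕ, (4 : ENNReal) ^ (j + 1) * ∫⁻ ξ in {ξ : ℝ | 2 ^ j ≤ |ξ|}, ‖𝓕 f ξ‖ₑ ^ 2 := by
    have e : ∀ j : ℕ, (4 : ENNReal) ^ (j + 1) * ∫⁻ ξ in {ξ : ℝ | 2 ^ j ≤ |ξ|}, ‖𝓕 f ξ‖ₑ ^ 2 =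
        ∫⁻ ξ, (4 : ENNReal) ^ (j + 1) * {ξ : ℝ | 2 ^ j ≤ |ξ|}.indicator 1 ξ * ‖𝓕 f ξ‖ₑ ^ 2 := by
      intro j
      rw [← lintegral_indicator (hm j), ← lintegral_const_mul _ (hgm.indicator (hm j))]
      refine lintegral_congr fun ξ => ?_
      by_cases h : ξ ∈ {ξ : ℝ | 2 ^ j ≤ |ξ|}
      · rw [Set.indicator_of_mem h, Set.indicator_of_mem h]; simp
      · rw [Set.indicator_of_notMem h, Set.indicator_of_notMem h]; simp
    simp_rw [e]
    rw [← lintegral_tsum, ← lintegral_add_left hgm]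
    · refine lintegral_mono fun ξ => ?_
      rw [ENNReal.tsum_mul_right]
      refine (mul_le_mul_left (sq_le_one_add_tsum_dyadic ξ) _).trans_eq ?_
      rw [add_mul, one_mul]
    · exact fun j => ((measurable_const.mul (measurable_one.indicator (hm j))).mul hgm).aemeasurable
  have hzero : ∫⁻ ξ, ‖𝓕 f ξ‖ₑ ^ 2 ≤ F := by
    rw [lintegral_enorm_fourier_sq hfi hfL]
    refine lintegral_mono fun x => le_mul_of_one_le_left' ((le_trans ?_ (hwt1 x)))
    rw [← ENNReal.ofReal_one]
    exact ENNReal.ofReal_le_ofReal (by nlinarith [sq_nonneg x])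
  -- the scales `j` with `R j < |x|` sum to a multiple of `Y²`, `Y = exp (4π |x| ^ s)`
  have htail : ∑' j : ℕ, (4 : ENNReal) ^ (j + 1) *
      ∫⁻ x in {x : ℝ | R j < |x|}, linearWeight f x ^ 2 ≤ 12 * F := by
    have e : ∀ j : ℕ, (4 : ENNReal) ^ (j + 1) * ∫⁻ x in {x : ℝ | R j < |x|}, linearWeight f x ^ 2 =
        ∫⁻ x, (4 : ENNReal) ^ (j + 1) *
          {x : ℝ | R j < |x|}.indicator (fun x => linearWeight f x ^ 2) x := by
      intro j
      rw [← lintegral_indicator (hm' j),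
        ← lintegral_const_mul _ ((hφm.pow_const 2).indicator (hm' j))]
    simp_rw [e]
    rw [← lintegral_tsum fun j => (((hφm.pow_const 2).indicator (hm' j)).const_mul _).aemeasurable,
      hFdef, ← lintegral_const_mul' _ _ (by simp)]
    refine lintegral_mono fun x => ?_
    set Y := Real.exp (4 * Real.pi * |x| ^ s) with hY
    have hY1 : 1 ≤ Y := Real.one_le_exp (by positivity)
    calc ∑' j : ℕ, (4 : ENNReal) ^ (j + 1) *
          {x : ℝ | R j < |x|}.indicator (fun x => linearWeight f x ^ 2) x
        ≤ ∑' j : ℕ, (if (2 : ℝ) ^ j < Y then (4 : ENNReal) ^ (j + 1) else 0) *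
            linearWeight f x ^ 2 := by
          refine ENNReal.tsum_le_tsum fun j => ?_
          by_cases h : x ∈ {x : ℝ | R j < |x|}
          · have h2 : (2 : ℝ) ^ j < Y := by
              have h3 : R j ^ s < |x| ^ s :=
                Real.rpow_lt_rpow (Real.rpow_nonneg (hlog j) _) h hs
              rw [hRdef, ← Real.rpow_mul (hlog j), one_div_mul_cancel hs.ne', Real.rpow_one,
                div_lt_iff₀ (by positivity)] at h3
              rw [hY, ← Real.log_lt_iff_lt_exp (by positivity)]
              linarith
            rw [Set.indicator_of_mem h, if_pos h2]
          · rw [Set.indicator_of_notMem h]; simp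
      _ ≤ 6 * ENNReal.ofReal (Y ^ 2) * (2 * (ENNReal.ofReal (1 + x ^ 2) * ‖f x‖ₑ ^ 2)) := by
          rw [ENNReal.tsum_mul_right]
          exact mul_le_mul' (tsum_dyadic_le hY1) (linearWeight_sq_le f x)
      _ = 12 * (ENNReal.ofReal (1 + x ^ 2) * ENNReal.ofReal (Y ^ 2) * ‖f x‖ₑ ^ 2) := by ring
      _ ≤ _ := by gcongr; exact hwt x
  have hgeom : ∑' j : ℕ, (4 : ENNReal) ^ (j + 1) * (8⁻¹ ^ j * (2 * F)) = 16 * F := by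
    have e : ∀ j : ℕ, (4 : ENNReal) ^ (j + 1) * (8⁻¹ ^ j * (2 * F)) = 2⁻¹ ^ j * (8 * F) := by
      intro j
      have h48 : (4 : ENNReal) * 8⁻¹ = 2⁻¹ := by
        rw [show (8 : ENNReal) = 4 * 2 by norm_num,
          ENNReal.mul_inv (Or.inl (by simp)) (Or.inl (by simp)), ← mul_assoc,
          ENNReal.mul_inv_cancel (by simp) (by simp), one_mul]
      rw [← h48, mul_pow]; ring
    simp_rw [e]
    rw [ENNReal.tsum_mul_right, ENNReal.tsum_geometric_two]; ring
  calc _ ≤ _ := hsplit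
    _ ≤ F + ∑' j : ℕ, (4 : ENNReal) ^ (j + 1) *
        ((2 + 2 * (A * A)) * (∫⁻ x in {x : ℝ | R j < |x|}, linearWeight f x ^ 2) +
        2 * (A * A) * (8⁻¹ ^ j * (2 * F))) :=
        add_le_add hzero (ENNReal.tsum_le_tsum fun j => mul_le_mul_right (hscale j) _)
    _ = F + ((2 + 2 * (A * A)) * (∑' j : ℕ, (4 : ENNReal) ^ (j + 1) *
        ∫⁻ x in {x : ℝ | R j < |x|}, linearWeight f x ^ 2) +
        2 * (A * A) * ∑' j : ℕ, (4 : ENNReal) ^ (j + 1) * (8⁻¹ ^ j * (2 * F))) := by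
        simp_rw [mul_add, mul_left_comm ((4 : ENNReal) ^ _)]
        rw [ENNReal.tsum_add, ENNReal.tsum_mul_left, ENNReal.tsum_mul_left]
    _ ≤ F + ((2 + 2 * (A * A)) * (12 * F) + 2 * (A * A) * (16 * F)) := by
        rw [hgeom]; gcongr
    _ = _ := by ring

/-! ### Growth rates of the sequences -/

theorem tendsto_log_div_rpow {s : ℝ} (hs : 0 < s) :
    Tendsto (fun x => Real.log x / x ^ s) atTop (𝓝 0) :=
  (isLittleO_log_rpow_atTop hs).tendsto_div_nhds_zero

/-- The counting function of the zeros on the space side has logarithm asymptotic to `4π x ^ s`. -/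
theorem tendsto_log_spaceCounting {s C : ℝ} (hs : 0 < s) (hC : 0 < C) :
    Tendsto (fun x => Real.log (x * (C * spaceWeight s x)) / (4 * Real.pi * x ^ s)) atTop
      (𝓝 1) := by
  have hpow : Tendsto (fun x : ℝ => x ^ s) atTop atTop := tendsto_rpow_atTop hs
  have hinv : Tendsto (fun x : ℝ => Real.log (1 + (x ^ 2)⁻¹)) atTop (𝓝 0) := by
    have h : Tendsto (fun x : ℝ => 1 + (x ^ 2)⁻¹) atTop (𝓝 (1 + 0)) :=
      tendsto_const_nhds.add (tendsto_inv_atTop_zero.comp (tendsto_pow_atTop two_ne_zero))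
    have h' := h.log (by norm_num)
    simpa using h'
  have h1 : Tendsto (fun x : ℝ => (Real.log C + Real.log (1 + (x ^ 2)⁻¹)) / x ^ s) atTop (𝓝 0) :=
    (tendsto_const_nhds.add hinv).div_atTop hpow
  have h2 : Tendsto (fun x : ℝ => 1 + (4 * Real.pi)⁻¹ * (3 * (Real.log x / x ^ s) +
      (Real.log C + Real.log (1 + (x ^ 2)⁻¹)) / x ^ s)) atTop
      (𝓝 (1 + (4 * Real.pi)⁻¹ * (3 * 0 + 0))) :=
    tendsto_const_nhds.add ((((tendsto_log_div_rpow hs).const_mul 3).add h1).const_mul _)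
  simp only [mul_zero, add_zero] at h2
  refine h2.congr' ?_
  filter_upwards [eventually_gt_atTop 0] with x hx
  have hxs : 0 < x ^ s := Real.rpow_pos_of_pos hx s
  have e : Real.log (x * (C * spaceWeight s x)) =
      3 * Real.log x + (Real.log C + Real.log (1 + (x ^ 2)⁻¹)) + 4 * Real.pi * x ^ s := by
    have e1 : x * (C * spaceWeight s x) =
        x ^ 3 * (C * (1 + (x ^ 2)⁻¹)) * Real.exp (4 * Real.pi * x ^ s) := by
      rw [spaceWeight, abs_of_pos hx]; field_simp; ring
    rw [e1, Real.log_mul (by positivity) (by positivity), Real.log_exp,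
      Real.log_mul (by positivity) (by positivity), Real.log_mul (by positivity) (by positivity),
      Real.log_pow]
    norm_num
  rw [e]
  have := Real.pi_pos
  field_simp
  ring

theorem tendsto_log_frequencyCounting {s : ℝ} (hs : 0 < s) :
    Tendsto (fun x => Real.log (x * frequencyDensity s x) / Real.log (1 + 2 * x)) atTop
      (𝓝 1) := by
  have hlin : Tendsto (fun x : ℝ => 1 + 2 * x) atTop atTop :=
    tendsto_atTop_add_const_left _ _ (tendsto_id.const_mul_atTop two_pos)
  have hlog : Tendsto (fun x : ℝ => Real.log (1 + 2 * x)) atTop atTop :=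
    Real.tendsto_log_atTop.comp hlin
  have hratio : Tendsto (fun x : ℝ => Real.log x / Real.log (1 + 2 * x)) atTop (𝓝 1) := by
    have h : Tendsto (fun x : ℝ => x⁻¹ + 2) atTop (𝓝 (0 + 2)) :=
      tendsto_inv_atTop_zero.add_const 2
    have h2 : Tendsto (fun x : ℝ => 1 - Real.log (x⁻¹ + 2) / Real.log (1 + 2 * x)) atTop
        (𝓝 (1 - 0)) :=
      tendsto_const_nhds.sub ((h.log (by norm_num)).div_atTop hlog)
    rw [sub_zero] at h2
    refine h2.congr' ?_
    filter_upwards [eventually_gt_atTop 0] with x hx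
    have hl : 0 < Real.log (1 + 2 * x) := Real.log_pos (by linarith)
    have e : Real.log (1 + 2 * x) = Real.log x + Real.log (x⁻¹ + 2) := by
      rw [← Real.log_mul (by positivity) (by positivity)]
      congr 1
      field_simp
    rw [eq_div_iff hl.ne', sub_mul, div_mul_cancel₀ _ hl.ne', e]
    ring
  -- in the variable `t = (log (1 + 2 x) / (4π)) ^ (1 / s)` the density is `2 t + 5`
  have ht : Tendsto (fun t : ℝ => Real.log (2 * t + 5) / t ^ s) atTop (𝓝 0) := by
    have h : Tendsto (fun t : ℝ => 2 + 5 * t⁻¹) atTop (𝓝 (2 + 5 * 0)) :=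
      tendsto_const_nhds.add (tendsto_inv_atTop_zero.const_mul 5)
    have h2 := (tendsto_log_div_rpow hs).add
      ((h.log (by norm_num)).div_atTop (tendsto_rpow_atTop hs))
    rw [zero_add] at h2
    refine h2.congr' ?_
    filter_upwards [eventually_gt_atTop 0] with t ht
    rw [← add_div, ← Real.log_mul (by positivity) (by positivity)]
    congr 2
    field_simp
  have hy : Tendsto (fun x : ℝ => (Real.log (1 + 2 * x) / (4 * Real.pi)) ^ (1 / s)) atTop atTop :=
    (tendsto_rpow_atTop (by positivity)).comp (hlog.atTop_div_const (by positivity))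
  have h3 := hratio.add ((ht.comp hy).const_mul (4 * Real.pi)⁻¹)
  simp only [mul_zero, add_zero] at h3
  refine h3.congr' ?_
  filter_upwards [eventually_gt_atTop 0] with x hx
  have hl : 0 < Real.log (1 + 2 * x) := Real.log_pos (by linarith)
  have hD : 0 < frequencyDensity s x := by unfold frequencyDensity; positivity
  have hpi := Real.pi_pos
  simp only [Function.comp]
  rw [← Real.rpow_mul (by positivity), one_div_mul_cancel hs.ne', Real.rpow_one,
    Real.log_mul hx.ne' hD.ne']
  change _ + (4 * Real.pi)⁻¹ * (Real.log (frequencyDensity s x) / _) = _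
  field_simp

theorem lambdaRate_isEquivalent {s C : ℝ} (hs : 0 < s) (hC : 0 < C) {x : ℕ → ℝ}
    (hx : Tendsto x atTop atTop) (hj : ∀ j, x j * (C * spaceWeight s (x j)) = j) :
    IsEquivalent atTop x (lambdaRate s) := by
  refine (isEquivalent_iff_exists_eq_mul.2 ⟨fun j =>
    (Real.log (x j * (C * spaceWeight s (x j))) / (4 * Real.pi * x j ^ s)) ^ (1 / s), ?_, ?_⟩ :
      IsEquivalent atTop (lambdaRate s) x).symm
  · have h := ((tendsto_log_spaceCounting hs hC).comp hx).rpow_const (p := 1 / s)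
      (Or.inl one_ne_zero)
    rwa [Real.one_rpow] at h
  · filter_upwards [hx.eventually_gt_atTop 0, eventually_ge_atTop 1] with j hj0 hj1
    have hlog : 0 ≤ Real.log j := Real.log_nonneg (by exact_mod_cast hj1)
    have hxs : 0 < x j ^ s := Real.rpow_pos_of_pos hj0 s
    rw [Pi.mul_apply, hj, lambdaRate]
    have e : (x j ^ s) ^ (1 / s) = x j := by
      rw [← Real.rpow_mul hj0.le, mul_one_div_cancel hs.ne', Real.rpow_one]
    nth_rewrite 2 [← e]
    rw [← Real.mul_rpow (by positivity) hxs.le]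
    congr 1
    have := Real.pi_pos
    field_simp

theorem muRate_isEquivalent {s : ℝ} (hs : 0 < s) {x : ℕ → ℝ}
    (hx : Tendsto x atTop atTop) (hj : ∀ᶠ j in atTop, x j * frequencyDensity s (x j) = j) :
    IsEquivalent atTop x (muRate s) := by
  set N : ℝ → ℝ := fun t => Real.log (t * frequencyDensity s t) with hN
  have hNr := tendsto_log_frequencyCounting hs
  have hlin : Tendsto (fun x : ℝ => 1 + 2 * x) atTop atTop :=
    tendsto_atTop_add_const_left _ _ (tendsto_id.const_mul_atTop two_pos)
  have hNtop : Tendsto N atTop atTop := by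
    refine Real.tendsto_log_atTop.comp (tendsto_atTop_mono' _ ?_ tendsto_id)
    filter_upwards [eventually_gt_atTop 0] with t ht
    have hl : 0 < Real.log (1 + 2 * t) := Real.log_pos (by linarith)
    refine le_mul_of_one_le_right ht.le ?_
    have : 0 ≤ (Real.log (1 + 2 * t) / (4 * Real.pi)) ^ (1 / s) := by positivity
    unfold frequencyDensity
    linarith
  have h1 : Tendsto (fun t => (Real.log (1 + 2 * t) / N t) ^ (1 / s)) atTop (𝓝 1) := by
    have h := (hNr.inv₀ one_ne_zero).rpow_const (p := 1 / s) (Or.inl (by norm_num))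
    simpa [inv_div] using h
  have h2 : Tendsto (fun t => 5 / 2 * (4 * Real.pi / N t) ^ (1 / s)) atTop (𝓝 0) := by
    have h := ((tendsto_const_nhds (x := 4 * Real.pi)).div_atTop hNtop).rpow_const (p := 1 / s)
      (Or.inr (by positivity))
    rw [Real.zero_rpow (by positivity)] at h
    simpa using h.const_mul (5 / 2)
  have h3 := (h1.add h2).comp hx
  rw [add_zero] at h3
  refine (isEquivalent_iff_exists_eq_mul.2 ⟨_, h3, ?_⟩ :
      IsEquivalent atTop (muRate s) x).symm
  filter_upwards [hx.eventually_gt_atTop 0, eventually_gt_atTop 1, hj] with j hj0 hj1 hje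
  have hlogj : 0 < Real.log j := Real.log_pos (by exact_mod_cast hj1)
  have hl : 0 < Real.log (1 + 2 * x j) := Real.log_pos (by linarith)
  have hpi := Real.pi_pos
  have e : (Real.log (1 + 2 * x j) / Real.log j) ^ (1 / s) =
      (Real.log (1 + 2 * x j) / (4 * Real.pi)) ^ (1 / s) *
        (4 * Real.pi / Real.log j) ^ (1 / s) := by
    rw [← Real.mul_rpow (by positivity) (by positivity)]
    congr 1
    field_simp
  simp only [Pi.mul_apply, Function.comp, hN, hje, muRate, e]
  conv_lhs => rw [← hje]
  unfold frequencyDensity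
  rw [show ((Real.log (x j * (2 * (Real.log (1 + 2 * x j) / (4 * Real.pi)) ^ (1 / s) + 5)))) =
    Real.log j from congrArg Real.log hje]
  ring

theorem tendsto_lambdaRate {j : ℕ} (hj : 2 ≤ j) :
    Tendsto (fun s : ℝ => lambdaRate s j) (𝓝[<] 1) (𝓝 (Real.log j / (4 * Real.pi))) := by
  have hlog : 0 < Real.log j := Real.log_pos (by exact_mod_cast hj)
  have hs : Tendsto (fun s : ℝ => 1 / s) (𝓝[<] 1) (𝓝 (1 / 1)) :=
    (tendsto_const_nhds.div tendsto_id one_ne_zero).mono_left nhdsWithin_le_nhds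
  have h := (tendsto_const_nhds (x := Real.log j / (4 * Real.pi))).rpow hs
    (Or.inl (by positivity))
  rwa [div_one, Real.rpow_one] at h

theorem tendsto_muRate {j : ℕ} (hj : 2 ≤ j) :
    Tendsto (fun s : ℝ => muRate s j) (𝓝[<] 1) (𝓝 (2 * Real.pi * j / Real.log j)) := by
  have hlog : 0 < Real.log j := Real.log_pos (by exact_mod_cast hj)
  have hs : Tendsto (fun s : ℝ => 1 / s) (𝓝[<] 1) (𝓝 (1 / 1)) :=
    (tendsto_const_nhds.div tendsto_id one_ne_zero).mono_left nhdsWithin_le_nhds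
  have h := ((tendsto_const_nhds (x := 4 * Real.pi / Real.log j)).rpow hs
    (Or.inl (by positivity))).const_mul ((j : ℝ) / 2)
  rw [div_one, Real.rpow_one] at h
  rwa [show (j : ℝ) / 2 * (4 * Real.pi / Real.log j) = 2 * Real.pi * j / Real.log j by ring] at h

/-! ### The uniqueness pair -/

theorem FourierSymmetricSobolev.integrable_fourier {f : ℝ → ℂ}
    (hf : f ∈ FourierSymmetricSobolev) : Integrable (𝓕 f) := by
  have hc := Real.continuous_fourier_of_integrable (FourierSymmetricSobolev.integrable hf)
  refine (hf.2.2.2.add integrable_inv_one_add_sq).mono' hc.aestronglyMeasurable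
    (Eventually.of_forall fun ξ => ?_)
  have h1 : (0 : ℝ) < 1 + ξ ^ 2 := by positivity
  have h2 : (1 + ξ ^ 2) * (1 + ξ ^ 2)⁻¹ = 1 := mul_inv_cancel₀ h1.ne'
  have h4 : 0 ≤ (1 + ξ ^ 2) * (‖𝓕 f ξ‖ - (1 + ξ ^ 2)⁻¹) ^ 2 := by positivity
  have h5 : (1 + ξ ^ 2) * (‖𝓕 f ξ‖ - (1 + ξ ^ 2)⁻¹) ^ 2
      = (1 + ξ ^ 2) * ‖𝓕 f ξ‖ ^ 2 - 2 * ‖𝓕 f ξ‖ * ((1 + ξ ^ 2) * (1 + ξ ^ 2)⁻¹)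
        + ((1 + ξ ^ 2) * (1 + ξ ^ 2)⁻¹) * (1 + ξ ^ 2)⁻¹ := by ring
  rw [h5, h2] at h4
  have h6 := norm_nonneg (𝓕 f ξ)
  simp only [Pi.add_apply]
  linarith

theorem FourierSymmetricSobolev.lintegral_sq_mul_fourier_lt_top {f : ℝ → ℂ}
    (hf : f ∈ FourierSymmetricSobolev) :
    ∫⁻ ξ, ENNReal.ofReal (ξ ^ 2) * ‖𝓕 f ξ‖ₑ ^ 2 < ⊤ := by
  refine (lintegral_mono fun ξ => ?_).trans_lt hf.2.2.2.lintegral_lt_top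
  rw [← ofReal_norm, ← ENNReal.ofReal_pow (norm_nonneg _), ← ENNReal.ofReal_mul (by positivity)]
  refine ENNReal.ofReal_le_ofReal ?_
  nlinarith [sq_nonneg ‖𝓕 f ξ‖]

theorem continuous_spaceWeight {s : ℝ} (hs : 0 ≤ s) : Continuous (spaceWeight s) :=
  (continuous_const.add (continuous_id.pow 2)).mul (Real.continuous_exp.comp
    (continuous_const.mul (continuous_abs.rpow_const fun _ => Or.inr hs)))

theorem monotoneOn_spaceWeight {s : ℝ} (hs : 0 ≤ s) :
    MonotoneOn (spaceWeight s) (Set.Ici 0) := by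
  intro x hx y hy hxy
  have hx' : 0 ≤ x := hx
  have hy' : 0 ≤ y := hy
  unfold spaceWeight
  rw [abs_of_nonneg hx', abs_of_nonneg hy']
  gcongr

theorem continuous_frequencyDensity_abs {s : ℝ} (hs : 0 ≤ s) :
    Continuous fun x => frequencyDensity s |x| := by
  unfold frequencyDensity
  refine (continuous_const.mul (Continuous.rpow_const ?_ fun _ => Or.inr (by positivity))).add
    continuous_const
  refine (Continuous.log (by fun_prop) fun x => ?_).div_const _
  positivity

theorem monotoneOn_frequencyDensity_abs {s : ℝ} (hs : 0 ≤ s) :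
    MonotoneOn (fun x => frequencyDensity s |x|) (Set.Ici 0) := by
  intro x hx y hy hxy
  have hx' : 0 ≤ x := hx
  have hy' : 0 ≤ y := hy
  have hl : 0 ≤ Real.log (1 + 2 * x) := Real.log_nonneg (by linarith)
  simp only [frequencyDensity, abs_of_nonneg hx', abs_of_nonneg hy']
  gcongr

theorem one_le_frequencyDensity {s x : ℝ} (hx : 0 ≤ x) : 1 ≤ frequencyDensity s x := by
  have hl : 0 ≤ Real.log (1 + 2 * x) := Real.log_nonneg (by linarith)
  have : 0 ≤ (Real.log (1 + 2 * x) / (4 * Real.pi)) ^ (1 / s) := by positivity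
  unfold frequencyDensity
  linarith

/-- The space side: zeros of `f` with density `C₀ · spaceWeight` bound the weighted norm of `f` by
its energy. -/
theorem lintegral_spaceWeight_sq_le {s C₀ : ℝ} (hs : 0 ≤ s) (hC₀ : 0 ≤ C₀) {f : ℝ → ℂ}
    (hf : f ∈ FourierSymmetricSobolev) {a : ℤ → ℝ} (ha : IsOrderedSequence a)
    (hgap : ∀ j, ∀ x ∈ Set.Icc (a j) (a (j + 1)),
      (a (j + 1) - a j) * (C₀ * spaceWeight s x) ≤ 1)
    (hz : ∀ j, f (a j) = 0) :
    ENNReal.ofReal (C₀ ^ 2) * ∫⁻ x, ENNReal.ofReal (spaceWeight s x) ^ 2 * ‖f x‖ₑ ^ 2 ≤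
      ENNReal.ofReal ((2 * Real.pi) ^ 2) * ∫⁻ ξ, ENNReal.ofReal (ξ ^ 2) * ‖𝓕 f ξ‖ₑ ^ 2 := by
  have h := lintegral_weight_sq_le_of_zeros hf.1 (FourierSymmetricSobolev.integrable hf)
    (FourierSymmetricSobolev.integrable_fourier hf) ha
    (W := fun x => ENNReal.ofReal (C₀ * spaceWeight s x))
    (ENNReal.measurable_ofReal.comp (continuous_const.mul (continuous_spaceWeight hs)).measurable)
    (fun x => ENNReal.ofReal_ne_top) (fun j x hx => ?_) hz
  · rw [← lintegral_const_mul' _ _ ENNReal.ofReal_ne_top,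
      ← lintegral_const_mul' _ _ ENNReal.ofReal_ne_top]
    refine (lintegral_congr fun x => ?_).trans_le (h.trans_eq (lintegral_congr fun ξ => ?_))
    · rw [ENNReal.ofReal_mul hC₀, mul_pow, ENNReal.ofReal_pow hC₀, mul_assoc]
    · have e : ‖(2 * Real.pi * Complex.I * ξ : ℂ)‖ₑ ^ 2 =
          ENNReal.ofReal ((2 * Real.pi) ^ 2) * ENNReal.ofReal (ξ ^ 2) := by
        rw [← ofReal_norm, ← ENNReal.ofReal_pow (norm_nonneg _),
          ← ENNReal.ofReal_mul (by positivity), ← mul_pow]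
        congr 1
        simp [mul_pow]
      rw [enorm_mul, mul_pow, e, mul_assoc]
  · rw [← ENNReal.ofReal_mul (sub_nonneg.2 (ha.1 (lt_add_one j)).le), ← ENNReal.ofReal_one]
    exact ENNReal.ofReal_le_ofReal (hgap j x (Set.Ioc_subset_Icc_self hx))

/-- For a large constant `C₀`, the estimates on the two sides contradict each other unless
`f = 0`. -/
theorem exists_isFourierUniquenessPair : ∃ C₀ : ℝ, 1 ≤ C₀ ∧ ∀ {s : ℝ}, 0 < s →
    ∀ {lam mu : ℤ → ℝ}, IsOrderedSequence lam → IsOrderedSequence mu →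
    (∀ j, ∀ x ∈ Set.Icc (lam j) (lam (j + 1)),
      (lam (j + 1) - lam j) * (C₀ * spaceWeight s x) ≤ 1) →
    (∀ j, ∀ ξ ∈ Set.Icc (mu j) (mu (j + 1)),
      (mu (j + 1) - mu j) * frequencyDensity s |ξ| ≤ 1) →
    IsFourierUniquenessPair (Set.range lam) (Set.range mu) FourierSymmetricSobolev := by
  obtain ⟨C, hC, hM⟩ := exists_lintegral_sq_mul_fourier_le
  set c := C.toReal with hc
  have hc0 : 0 ≤ c := ENNReal.toReal_nonneg
  refine ⟨1 + 2 * ((2 * Real.pi) ^ 2 * c), le_add_of_nonneg_right (by positivity), ?_⟩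
  intro s hs lam mu hlam hmu hlgap hmgap f hf hfz hgz
  -- this choice gives `4π² c = (C₀ - 1) / 2 < C₀²`
  set C₀ := 1 + 2 * ((2 * Real.pi) ^ 2 * c) with hC₀
  have hC₀1 : 1 ≤ C₀ := le_add_of_nonneg_right (by positivity)
  set F := ∫⁻ x, ENNReal.ofReal (spaceWeight s x) ^ 2 * ‖f x‖ₑ ^ 2 with hF
  set G := ∫⁻ ξ, ENNReal.ofReal (ξ ^ 2) * ‖𝓕 f ξ‖ₑ ^ 2 with hG
  have hGt : G ≠ ⊤ := (FourierSymmetricSobolev.lintegral_sq_mul_fourier_lt_top hf).ne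
  have h1 : ENNReal.ofReal (C₀ ^ 2) * F ≤ ENNReal.ofReal ((2 * Real.pi) ^ 2) * G :=
    lintegral_spaceWeight_sq_le hs.le (by linarith) hf hlam hlgap fun j => hfz _ ⟨j, rfl⟩
  have hFt : F ≠ ⊤ := by
    have h : F ≤ ENNReal.ofReal (C₀ ^ 2) * F := by
      refine le_mul_of_one_le_left' ?_
      rw [← ENNReal.ofReal_one]
      exact ENNReal.ofReal_le_ofReal (one_le_pow₀ hC₀1)
    exact ne_top_of_le_ne_top (ENNReal.mul_ne_top ENNReal.ofReal_ne_top hGt) (h.trans h1)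
  have h2 : G ≤ C * F := hM hs hf.1 (lt_top_iff_ne_top.2 hFt) hmu (fun j => hgz _ ⟨j, rfl⟩) hmgap
  have hF0 : F = 0 := by
    have r1 := ENNReal.toReal_mono (ENNReal.mul_ne_top ENNReal.ofReal_ne_top hGt) h1
    have r2 := ENNReal.toReal_mono (ENNReal.mul_ne_top hC hFt) h2
    rw [ENNReal.toReal_mul, ENNReal.toReal_mul, ENNReal.toReal_ofReal (by positivity),
      ENNReal.toReal_ofReal (by positivity)] at r1
    rw [ENNReal.toReal_mul, ← hc] at r2
    have hF' : 0 ≤ F.toReal := ENNReal.toReal_nonneg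
    have r3 : C₀ ^ 2 * F.toReal ≤ ((2 * Real.pi) ^ 2 * c) * F.toReal := by
      rw [mul_assoc]
      exact r1.trans (mul_le_mul_of_nonneg_left r2 (by positivity))
    have r4 : (2 * Real.pi) ^ 2 * c = (C₀ - 1) / 2 := by rw [hC₀]; ring
    rw [r4] at r3
    have r5 : F.toReal ≤ 0 := by nlinarith [mul_nonneg hF' (sub_nonneg.2 hC₀1)]
    exact ((ENNReal.toReal_eq_zero_iff _).1 (le_antisymm r5 hF')).resolve_right hFt
  have hm : Measurable fun x => ENNReal.ofReal (spaceWeight s x) ^ 2 * ‖f x‖ₑ ^ 2 :=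
    ((ENNReal.measurable_ofReal.comp (continuous_spaceWeight hs.le).measurable).pow_const 2).mul
      (hf.1.enorm.measurable.pow_const 2)
  have hae := (lintegral_eq_zero_iff hm).1 hF0
  refine (Continuous.ae_eq_iff_eq volume hf.1 continuous_const).1 (hae.mono fun x hx => ?_)
  have hw : 0 < spaceWeight s x := by unfold spaceWeight; positivity
  have h0 : f x = 0 := by simpa [not_le.2 hw] using hx
  exact h0

theorem mainTheorem4 :
    (∀ s : ℝ, 0 < s → s < 1 →
      ∃ lam mu : ℤ → ℝ,
        IsOrderedSequence lam ∧ IsOrderedSequence mu ∧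
        IsEquivalent atTop (fun j : ℕ => lam (j : ℤ)) (lambdaRate s) ∧
        IsEquivalent atTop (fun j : ℕ => -lam (-(j : ℤ))) (lambdaRate s) ∧
        IsEquivalent atTop (fun j : ℕ => mu (j : ℤ)) (muRate s) ∧
        IsEquivalent atTop (fun j : ℕ => -mu (-(j : ℤ))) (muRate s) ∧
        IsFourierUniquenessPair (Set.range lam) (Set.range mu) FourierSymmetricSobolev) ∧
    (∀ j : ℕ, 2 ≤ j →
      Tendsto (fun s : ℝ => lambdaRate s j) (𝓝[<] 1) (𝓝 (Real.log j / (4 * Real.pi))) ∧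
      Tendsto (fun s : ℝ => muRate s j) (𝓝[<] 1) (𝓝 (2 * Real.pi * j / Real.log j))) := by
  refine ⟨fun s hs _ => ?_, fun j hj => ⟨tendsto_lambdaRate hj, tendsto_muRate hj⟩⟩
  obtain ⟨C₀, hC₀, hpair⟩ := exists_isFourierUniquenessPair
  have hw : ∀ x, spaceWeight s |x| = spaceWeight s x := fun x => by simp [spaceWeight]
  obtain ⟨lam, hlam, hlneg, hlval, hlgap⟩ := exists_sequence_of_density
    (ρ := fun x => C₀ * spaceWeight s x) (continuous_const.mul (continuous_spaceWeight hs.le))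
    (fun x hx y hy hxy => mul_le_mul_of_nonneg_left (monotoneOn_spaceWeight hs.le hx hy hxy)
      (by linarith))
    (fun x _ => by nlinarith [one_add_sq_le_spaceWeight s x, sq_nonneg x])
  obtain ⟨mu, hmu, hmneg, hmval, hmgap⟩ := exists_sequence_of_density
    (continuous_frequencyDensity_abs hs.le) (monotoneOn_frequencyDensity_abs hs.le)
    (fun x _ => one_le_frequencyDensity (abs_nonneg x))
  simp only [hw] at hlval hlgap
  simp only [abs_abs] at hmval hmgap
  have hlt : Tendsto (fun j : ℕ => lam (j : ℤ)) atTop atTop :=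
    hlam.2.1.comp tendsto_natCast_atTop_atTop
  have hmt : Tendsto (fun j : ℕ => mu (j : ℤ)) atTop atTop :=
    hmu.2.1.comp tendsto_natCast_atTop_atTop
  have hle := lambdaRate_isEquivalent hs (by linarith : 0 < C₀) hlt
    (fun j => by simpa using hlval j)
  have hme := muRate_isEquivalent hs hmt (by
    filter_upwards [hmt.eventually_gt_atTop 0] with j hj
    simpa [abs_of_pos hj] using hmval j)
  exact ⟨lam, mu, hlam, hmu, hle, by simpa [hlneg] using hle, hme, by simpa [hmneg] using hme,
    hpair hs hlam hmu hlgap hmgap⟩
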